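/- Let $\Omega=\{0,1\}^{\mathbb N}$ be the Cantor space. Let $P_1$ be a computable probability measure on $\Omega_1=\Omega$, and let $(P^\omega)_{\omega\in\Omega_1}$ be a family of probability measures on $\Omega_2=\Omega$ that is computable uniformly in $\omega$: one machine with oracle $\omega$ approximates, for every $\omega\in\Omega_1$, every binary string $v$ and every $n$, the value $P^\omega([v])$ with error at most $2^{-n}$, where $[v]$ is the set of infinite extensions of $v$. Let $P$ be the probability measure on $\Omega_1\times\Omega_2$ with $\iint f\,dP=\int\!\int f(\omega,\omega')\,dP^\omega(\omega')\,dP_1(\omega)$. A $P_1$-test is a lower semicomputable function $t:\Omega_1\to[0,\infty]$ with $\int t\,dP_1\le 1$; a $P$-test is a lower semicomputable $t:\Omega_1\times\Omega_2\to[0,\infty]$ with $\iint t\,dP\le 1$; a conditional test is a lower semicomputable $t:\Omega_2\times\Omega_1\times\mathbb Z\to[0,\infty]$ with $\int t(\omega',\omega,k)\,dP^\omega(\omega')\le 1$ for all $\omega\in\Omega_1$ and $k\in\mathbb Z$. In each of the three classes, a test is maximal if every test of that class is bounded by a constant multiple of it. **Theorem (Vovk–Vyugin).** Maximal tests of all three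 kinds exist. Let $\mathbf t_{P_1}(\omega)$, $\mathbf t_P(\omega,\omega')$, $\mathbf t_{P^\omega}(\omega'\mid\omega,k)$ be any maximal tests, and let $\mathbf d_{P_1}$, $\mathbf d_P$, $\mathbf d_{P^\omega}$ be their binary logarithms, with values in $[-\infty,+\infty]$. Then $$\mathbf d_P(\omega,\omega')=\mathbf d_{P_1}(\omega)+\mathbf d_{P^\omega}\bigl(\omega'\mid\omega,\mathbf d_{P_1}(\omega)\bigr)+O(1)$$ for all $\omega\in\Omega_1$ and $\omega'\in\Omega_2$. Here $\mathbf d_{P_1}(\omega)$ in the condition is rounded to an integer $k$ in any way with bounded error: for every $r$ there is a $c$, not depending on $\omega$, $\omega'$ and $k$, such that the two sides differ by at most $c$ (infinite values being equal) for every $\omega$, $\omega'$ and every integer $k$ with $|k-\mathbf d_{P_1}(\omega)|\le r$ put in the condition; if $\mathbf d_{P_1}(\omega)=+\infty$, then $k$ may be any integer, and both sides are $+\infty$. -/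

import Mathlib

open MeasureTheory ProbabilityTheory
open scoped ENNReal NNReal

namespace VovkVyugin

/-- The Cantor space of infinite binary sequences (with its product topology and the product
`σ`-algebra, which is the Borel one). -/
abbrev Cantor : Type := ℕ → Bool

/-- The prefix of length `n` of an infinite sequence. -/
def initSeg (ω : Cantor) (n : ℕ) : List Bool := (List.range n).map ω

/-- The interval `[u]` of all infinite extensions of the string `u`. -/
def cyl (u : List Bool) : Set Cantor := {ω | initSeg ω u.length = u}

/-- The standard base of `Ω₁ × Ω₂`, consisting of the products `[u] × [v]`. -/
def cylPair (p : List Bool × List Bool) : Set (Cantor × Cantor) :=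
  cyl p.1 ×ˢ cyl p.2

/-- The standard base of `Ω₂ × Ω₁ × ℤ`, consisting of the sets `[v] × [u] × {k}`. -/
def cylCond (p : List Bool × List Bool × ℤ) : Set (Cantor × Cantor × ℤ) :=
  cyl p.1 ×ˢ cyl p.2.1 ×ˢ {p.2.2}

/-- A function `f : X → [0, ∞]` is lower semicomputable (with respect to an effectively indexed
base `B` of `X`) if the sets `{x | q < f x}` are effectively open, uniformly in the non-negative
rational `q = a / (b + 1)`: they are unions of base sets listed by one enumerable set `W`. -/
def LowerSemicomputable {X ι : Type} [Primcodable ι] (B : ι → Set X) (f : X → ℝ≥0∞) : Prop :=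
  ∃ W : ι × ℕ × ℕ → Prop, REPred W ∧
    ∀ (a b : ℕ) (x : X), (a : ℝ≥0∞) / ((b : ℝ≥0∞) + 1) < f x ↔ ∃ i, W (i, a, b) ∧ x ∈ B i

/-- A finite measure on the Cantor space is computable if the measures of the intervals `[u]` are
computable reals uniformly in `u`: an algorithm produces, given `u` and `n`, a rational
approximation with error at most `2⁻ⁿ`. -/
def IsComputableMeasure (μ : Measure Cantor) : Prop :=
  ∃ A : List Bool → ℕ → ℕ, Computable₂ A ∧
    ∀ u n, |μ.real (cyl u) - (A u n : ℝ) / 2 ^ n| ≤ 1 / 2 ^ n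

/-- The measures `κ ω` are computable uniformly in `ω`: one machine with oracle `ω` produces, given
`v` and `n`, an approximation to `κ ω [v]` with error at most `2⁻ⁿ`. Here `Φ (initSeg ω s) (v, n)`
is the state of the output after `s` steps, in which the machine could read only the first `s`
bits of the oracle (`none` if there is no answer yet). The machine has to answer for every `ω`. -/
def IsUniformlyComputable (κ : Kernel Cantor Cantor) : Prop :=
  ∃ Φ : List Bool → List Bool × ℕ → Option ℕ, Computable₂ Φ ∧
    ∀ (ω : Cantor) (v : List Bool) (n : ℕ),
      (∃ s a, Φ (initSeg ω s) (v, n) = some a) ∧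
      ∀ s a, Φ (initSeg ω s) (v, n) = some a →
        |(κ ω).real (cyl v) - (a : ℝ) / 2 ^ n| ≤ 1 / 2 ^ n

/-- Expectation-bounded randomness tests with respect to `μ`. -/
structure IsTest {X ι : Type} [Primcodable ι] [MeasurableSpace X] (B : ι → Set X)
    (μ : Measure X) (t : X → ℝ≥0∞) : Prop where
  lowerSemicomputable : LowerSemicomputable B t
  lintegral_le_one : ∫⁻ x, t x ∂μ ≤ 1

/-- A test that is maximal up to a constant factor. -/
structure IsMaximalTest {X ι : Type} [Primcodable ι] [MeasurableSpace X] (B : ι → Set X)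
    (μ : Measure X) (t : X → ℝ≥0∞) : Prop where
  isTest : IsTest B μ t
  maximal : ∀ s : X → ℝ≥0∞, IsTest B μ s → ∃ C : ℝ≥0, ∀ x, s x ≤ C * t x

/-- Conditional tests `t (ω', ω, k)`: tests in `ω'` with respect to `κ ω`, given the sequence `ω`
and the integer `k`. -/
structure IsCondTest (κ : Kernel Cantor Cantor) (t : Cantor × Cantor × ℤ → ℝ≥0∞) : Prop where
  lowerSemicomputable : LowerSemicomputable cylCond t
  lintegral_le_one : ∀ (ω : Cantor) (k : ℤ), ∫⁻ ω', t (ω', ω, k) ∂(κ ω) ≤ 1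

/-- A conditional test that is maximal up to a constant factor. -/
structure IsMaximalCondTest (κ : Kernel Cantor Cantor) (t : Cantor × Cantor × ℤ → ℝ≥0∞) :
    Prop where
  isCondTest : IsCondTest κ t
  maximal : ∀ s : Cantor × Cantor × ℤ → ℝ≥0∞, IsCondTest κ s → ∃ C : ℝ≥0, ∀ x, s x ≤ C * t x

/-- The binary logarithm `[0, ∞] → [-∞, ∞]`. -/
noncomputable def log2 (x : ℝ≥0∞) : EReal := ENNReal.log x / ((Real.log 2 : ℝ) : EReal)

/-- The randomness deficiency corresponding to a (maximal) test. -/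
noncomputable def deficiency {X : Type} (t : X → ℝ≥0∞) (x : X) : EReal := log2 (t x)

/-- The integer `k` is a rounding of `x` with error at most `r`. An infinite value has no nearby
integer, and any integer is admitted for it. -/
def IsRounding (r : ℝ) (x : EReal) (k : ℤ) : Prop :=
  x ≠ ⊤ → x ≤ (((k : ℝ) + r : ℝ) : EReal) ∧ (((k : ℝ) - r : ℝ) : EReal) ≤ x

end VovkVyugin

open VovkVyugin

/-!
A universal test is a weighted supremum over all programs of the functions they enumerate, each
trimmed to those of its levels whose integral is small. The integral of a level depends on finitely
many values `P^ω([v])`, so that its being small is eventually confirmed, and trimming does not cut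
off anything from an actual test. It even keeps an enumerated function intact at every single `ω`
where its integral is at most `1`, so a maximal conditional test dominates it there.

For the upper bound, the marginal `ω ↦ ∫ s(ω, ω') dP^ω(ω')` of a `P`-test `s` is a `P₁`-test, hence
is at most `2 ^ A * t₁(ω)`. Consequently `2 ^ (-k - O(1)) * s(ω, ·)` has integral at most `1` at
every `ω` with `t₁(ω) ≲ 2 ^ k`, and is dominated by `t₂(· | ω, k)`.

For the lower bound, the supremum of `2 ^ k * t₂(ω' | ω, k)` over all `k` with
`2 ^ k < 2 ^ j * t₁(ω)` is lower semicomputable, because the condition on `k` is semidecidable, and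
its integral over `ω'` is at most a geometric sum `≤ 2 ^ (j + 1) * t₁(ω)`.
Up to a factor it is a `P`-test, and by both bounds together it is a maximal one.
-/

namespace VovkVyugin

open Encodable (encode decode)
open Nat.Partrec (Code)

attribute [local fun_prop] Primrec Primrec.const Primrec.comp Primrec.fst Primrec.snd
  Primrec.encode Primrec.decode Primrec.unpair Primrec.list_length Primrec.list_range
attribute [local fun_prop] Computable Computable.id Computable.const Computable.comp Computable.fst
  Computable.snd Computable.encode

section Computability

variable {α β γ : Type*} [Primcodable α] [Primcodable β] [Primcodable γ]

@[fun_prop]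
theorem primrec_pair {f : α → β} {g : α → γ} (hf : Primrec f) (hg : Primrec g) :
    Primrec fun a => (f a, g a) :=
  hf.pair hg

@[fun_prop]
theorem computable_pair {f : α → β} {g : α → γ} (hf : Computable f) (hg : Computable g) :
    Computable fun a => (f a, g a) :=
  hf.pair hg

@[fun_prop]
theorem computable_list_length {f : α → List β} (hf : Computable f) :
    Computable fun a => (f a).length :=
  Computable.list_length.comp hf

@[fun_prop]
theorem computable_nat_mul {f g : α → ℕ} (hf : Computable f) (hg : Computable g) :
    Computable fun a => f a * g a :=
  Primrec.nat_mul.to_comp.comp hf hg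

@[fun_prop]
theorem computable_nat_sub {f g : α → ℕ} (hf : Computable f) (hg : Computable g) :
    Computable fun a => f a - g a :=
  Primrec.nat_sub.to_comp.comp hf hg

@[fun_prop]
theorem primrec_list_take {f : α → List β} {n : α → ℕ} (hf : Primrec f) (hn : Primrec n) :
    Primrec fun a => (f a).take (n a) :=
  Primrec.list_take.comp hn hf

@[fun_prop]
theorem computable_list_take {f : α → List β} {n : α → ℕ} (hf : Computable f) (hn : Computable n) :
    Computable fun a => (f a).take (n a) :=
  Primrec.list_take.to_comp.comp hn hf

@[fun_prop]
theorem computable_nat_add {f g : α → ℕ} (hf : Computable f) (hg : Computable g) :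
    Computable fun a => f a + g a :=
  Primrec.nat_add.to_comp.comp hf hg

theorem primrec_of_int {f : ℤ → α} (hf : Primrec fun n : ℕ => f n)
    (hf' : Primrec fun n : ℕ => f (Int.negSucc n)) : Primrec f := by
  have hequiv : Primrec Equiv.intEquivNatSumNat :=
    Primrec.encode_iff.1 (Primrec.encode.of_eq fun k => by cases k <;> rfl)
  exact (Primrec.sumCasesOn hequiv (hf.comp .snd).to₂ (hf'.comp .snd).to₂).of_eq fun k => by
    cases k <;> rfl

theorem primrec_int_toNat : Primrec Int.toNat :=
  primrec_of_int .id (Primrec.const 0)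

theorem primrec_int_neg : Primrec fun k : ℤ => -k := by
  have hcast : Primrec fun n : ℕ => (n : ℤ) :=
    Primrec.encode_iff.1 (Primrec.nat_double.of_eq fun _ => rfl)
  have hnegSucc : Primrec Int.negSucc :=
    Primrec.encode_iff.1 (Primrec.nat_double_succ.of_eq fun _ => rfl)
  refine primrec_of_int ?_ (hcast.comp .succ)
  exact (Primrec.nat_casesOn .id (.const 0) (hnegSucc.comp .snd).to₂).of_eq fun n => by
    cases n <;> rfl

@[fun_prop]
theorem computable_int_toNat {f : α → ℤ} (hf : Computable f) : Computable fun a => (f a).toNat :=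
  primrec_int_toNat.to_comp.comp hf

@[fun_prop]
theorem computable_int_neg {f : α → ℤ} (hf : Computable f) : Computable fun a => -f a :=
  primrec_int_neg.to_comp.comp hf

@[fun_prop]
theorem computable_nat_pow {f g : α → ℕ} (hf : Computable f) (hg : Computable g) :
    Computable fun a => f a ^ g a :=
  (Primrec₂.unpaired'.1 Nat.Primrec.pow).to_comp.comp hf hg

theorem rePred_comp {p : β → Prop} (hp : REPred p) {f : α → β} (hf : Computable f) :
    REPred fun a => p (f a) :=
  Partrec.comp hp hf

theorem rePred_and {p q : α → Prop} (hp : REPred p) (hq : REPred q) :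
    REPred fun a => p a ∧ q a :=
  (Partrec.bind hp (g := fun a _ => Part.assert (q a) fun _ => Part.some ())
    (Partrec.comp hq Computable.fst)).of_eq fun a => by ext; simp

theorem rePred_eq {f g : α → β} (hf : Computable f) (hg : Computable g) :
    REPred fun a => f a = g a :=
  rePred_comp Primrec.eq.computablePred.to_re (hf.pair hg)

theorem rePred_lt {f g : α → ℕ} (hf : Computable f) (hg : Computable g) :
    REPred fun a => f a < g a :=
  rePred_comp Primrec.nat_lt.computablePred.to_re (hf.pair hg)

theorem exists_code_of_rePred {p : α → Prop} (hp : REPred p) :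
    ∃ c : Code, ∀ a, p a ↔ ∃ s, (c.evaln s (encode a)).isSome := by
  obtain ⟨c, hc⟩ := Code.exists_code.1 hp
  refine ⟨c, fun a => ?_⟩
  have accepts_iff : p a ↔ ∃ x, x ∈ c.eval (encode a) := by
    rw [hc]; simp
  simp only [accepts_iff, Option.isSome_iff_exists, Code.evaln_complete, Option.mem_def]
  exact exists_comm

@[fun_prop]
theorem primrec_evaln {f : α → Code} {s n : α → ℕ} (hf : Primrec f) (hs : Primrec s)
    (hn : Primrec n) : Primrec fun a => (f a).evaln (s a) (n a) :=
  Code.primrec_evaln.comp ((hs.pair hf).pair hn)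

theorem rePred_exists {p : α × β → Prop} (hp : REPred p) : REPred fun a => ∃ b, p (a, b) := by
  obtain ⟨c, hc⟩ := exists_code_of_rePred hp
  have hf : Primrec fun x : α × ℕ => (decode (α := β) x.2.unpair.2).bind fun b =>
      c.evaln x.2.unpair.1 (encode (x.1, b)) :=
    Primrec.option_bind (by fun_prop) (show Primrec fun y : (α × ℕ) × β =>
      c.evaln y.1.2.unpair.1 (encode (y.1.1, y.2)) by fun_prop).to₂
  refine (Partrec.rfindOpt hf.to_comp.to₂).dom_re.of_eq fun a => ?_
  simp only [Nat.rfindOpt_dom, hc, Option.isSome_iff_exists]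
  constructor
  · rintro ⟨n, y, hy⟩
    obtain ⟨b, -, hb⟩ := Option.bind_eq_some_iff.1 hy
    exact ⟨b, _, y, hb⟩
  · rintro ⟨b, s, y, hy⟩
    exact ⟨Nat.pair s (encode b), y, by simpa using hy⟩

end Computability

section EffectivelyOpen

variable {X Y ι ι' α β : Type} [Primcodable ι] [Primcodable ι'] [Primcodable α] [Primcodable β]
  {B : ι → Set X} {B' : ι' → Set Y}

/-- The sets `A p` are effectively open, uniformly in the parameter `p`: they are unions of base
sets listed by one enumerable set `W`. -/
def EffectivelyOpen (B : ι → Set X) (A : α → Set X) : Prop :=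
  ∃ W : ι × α → Prop, REPred W ∧ ∀ p x, x ∈ A p ↔ ∃ i, W (i, p) ∧ x ∈ B i

namespace EffectivelyOpen

theorem congr {A A' : α → Set X} (hA : EffectivelyOpen B A) (h : ∀ p x, x ∈ A' p ↔ x ∈ A p) :
    EffectivelyOpen B A' := by
  rwa [show A' = A from funext fun p => Set.ext (h p)]

theorem comp {A : α → Set X} (hA : EffectivelyOpen B A) {g : β → α} (hg : Computable g) :
    EffectivelyOpen B fun p => A (g p) := by
  obtain ⟨W, hW, hA⟩ := hA
  exact ⟨fun y => W (y.1, g y.2), rePred_comp hW (by fun_prop), fun p => hA (g p)⟩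

theorem iUnion {A : α × β → Set X} (hA : EffectivelyOpen B A) :
    EffectivelyOpen B fun a => ⋃ b, A (a, b) := by
  obtain ⟨W, hW, hA⟩ := hA
  refine ⟨fun y => ∃ b, W (y.1, y.2, b), rePred_exists (p := fun y : (ι × α) × β =>
    W (y.1.1, y.1.2, y.2)) (rePred_comp hW (by fun_prop)), fun a x => ?_⟩
  simp only [Set.mem_iUnion, hA]
  tauto

theorem preimage {A : α → Set Y} (hA : EffectivelyOpen B' A) {g : X → Y}
    (hg : EffectivelyOpen B fun j => g ⁻¹' B' j) : EffectivelyOpen B fun p => g ⁻¹' A p := by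
  obtain ⟨W, hW, hA⟩ := hA
  obtain ⟨V, hV, hg⟩ := hg
  refine ⟨fun y => ∃ j, V (y.1, j) ∧ W (j, y.2), rePred_exists (p := fun y : (ι × α) × ι' =>
    V (y.1.1, y.2) ∧ W (y.2, y.1.2)) (rePred_and (rePred_comp hV (by fun_prop))
      (rePred_comp hW (by fun_prop))), fun p x => ?_⟩
  simp only [Set.mem_preimage] at hg
  simp only [Set.mem_preimage, hA, hg]
  tauto

theorem inter (hB : EffectivelyOpen B fun j : ι × ι => B j.1 ∩ B j.2) {A A' : α → Set X}
    (hA : EffectivelyOpen B A) (hA' : EffectivelyOpen B A') :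
    EffectivelyOpen B fun p => A p ∩ A' p := by
  obtain ⟨V, hV, hB⟩ := hB
  obtain ⟨W, hW, hA⟩ := hA
  obtain ⟨W', hW', hA'⟩ := hA'
  refine ⟨fun y => ∃ j : ι × ι, V (y.1, j) ∧ W (j.1, y.2) ∧ W' (j.2, y.2),
    rePred_exists (p := fun y : (ι × α) × ι × ι => V (y.1.1, y.2) ∧ W (y.2.1, y.1.2) ∧
      W' (y.2.2, y.1.2)) (rePred_and (rePred_comp hV (by fun_prop)) (rePred_and
        (rePred_comp hW (by fun_prop)) (rePred_comp hW' (by fun_prop)))), fun p x => ?_⟩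
  simp only [Set.mem_inter_iff, Prod.forall] at hB
  simp only [Set.mem_inter_iff, hA, hA', Prod.exists]
  constructor
  · rintro ⟨⟨i, hi, hxi⟩, j, hj, hxj⟩
    obtain ⟨k, hk, hxk⟩ := (hB i j x).1 ⟨hxi, hxj⟩
    exact ⟨k, ⟨i, j, hk, hi, hj⟩, hxk⟩
  · rintro ⟨k, ⟨i, j, hk, hi, hj⟩, hxk⟩
    obtain ⟨hxi, hxj⟩ := (hB i j x).2 ⟨k, hk, hxk⟩
    exact ⟨⟨i, hi, hxi⟩, j, hj, hxj⟩

end EffectivelyOpen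

end EffectivelyOpen

section Cylinders

variable {α : Type} [Primcodable α]

theorem length_initSeg (ω : Cantor) (n : ℕ) : (initSeg ω n).length = n := by
  simp [initSeg]

theorem take_initSeg (ω : Cantor) (m n : ℕ) : (initSeg ω n).take m = initSeg ω (min m n) := by
  simp [initSeg, ← List.map_take, List.take_range]

theorem mem_cyl {ω : Cantor} {u : List Bool} : ω ∈ cyl u ↔ initSeg ω u.length = u :=
  Iff.rfl

theorem mem_cyl_initSeg (ω : Cantor) (n : ℕ) : ω ∈ cyl (initSeg ω n) := by
  rw [mem_cyl, length_initSeg]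

theorem effectivelyOpen_cyl_setOf_initSeg {V : α × List Bool → Prop} (hV : REPred V) {n : α → ℕ}
    (hn : Computable n) : EffectivelyOpen cyl fun p => {ω | V (p, initSeg ω (n p))} := by
  refine ⟨fun y => y.1.length = n y.2 ∧ V (y.2, y.1), rePred_and (rePred_eq (by fun_prop)
    (by fun_prop)) (rePred_comp hV (by fun_prop)), fun p ω => ⟨fun h => ⟨initSeg ω (n p),
      ⟨length_initSeg _ _, h⟩, mem_cyl_initSeg _ _⟩, ?_⟩⟩
  rintro ⟨u, ⟨hu, h⟩, hω⟩
  rwa [← mem_cyl.1 hω, hu] at h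

theorem effectivelyOpen_cylPair_setOf_initSeg {V : α × List Bool × List Bool → Prop}
    (hV : REPred V) {n : α → ℕ} (hn : Computable n) :
    EffectivelyOpen cylPair fun p => {x | V (p, initSeg x.1 (n p), initSeg x.2 (n p))} := by
  refine ⟨fun y => (y.1.1.length = n y.2 ∧ y.1.2.length = n y.2) ∧ V (y.2, y.1),
    rePred_and (rePred_and (rePred_eq (by fun_prop) (by fun_prop))
      (rePred_eq (by fun_prop) (by fun_prop))) (rePred_comp hV (by fun_prop)),
    fun p x => ⟨fun h => ⟨(initSeg x.1 (n p), initSeg x.2 (n p)),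
      ⟨⟨length_initSeg _ _, length_initSeg _ _⟩, h⟩, mem_cyl_initSeg _ _, mem_cyl_initSeg _ _⟩, ?_⟩⟩
  rintro ⟨⟨u, v⟩, ⟨⟨hu, hv⟩, h⟩, hω, hω'⟩
  dsimp only at hu hv h hω hω'
  rwa [← mem_cyl.1 hω, ← mem_cyl.1 hω', hu, hv] at h

theorem effectivelyOpen_preimage_fst : EffectivelyOpen cylPair fun u => Prod.fst ⁻¹' cyl u := by
  refine (effectivelyOpen_cylPair_setOf_initSeg (V := fun y => y.2.1 = y.1)
    (rePred_eq (by fun_prop) (by fun_prop)) (n := List.length) (by fun_prop)).congr fun u x => ?_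
  rfl

theorem effectivelyOpen_preimage_snd : EffectivelyOpen cylPair fun u => Prod.snd ⁻¹' cyl u := by
  refine (effectivelyOpen_cylPair_setOf_initSeg (V := fun y => y.2.2 = y.1)
    (rePred_eq (by fun_prop) (by fun_prop)) (n := List.length) (by fun_prop)).congr fun u x => ?_
  rfl

theorem effectivelyOpen_cylPair_inter :
    EffectivelyOpen cylPair fun j : (List Bool × List Bool) × List Bool × List Bool =>
      cylPair j.1 ∩ cylPair j.2 := by
  refine (effectivelyOpen_cylPair_setOf_initSeg
    (α := (List Bool × List Bool) × List Bool × List Bool) (V := fun y =>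
      (y.2.1.take y.1.1.1.length, y.2.2.take y.1.1.2.length) = y.1.1 ∧
      (y.2.1.take y.1.2.1.length, y.2.2.take y.1.2.2.length) = y.1.2)
    (rePred_and (rePred_eq (by fun_prop) (by fun_prop)) (rePred_eq (by fun_prop) (by fun_prop)))
    (n := fun j => j.1.1.length + j.1.2.length + (j.2.1.length + j.2.2.length))
    (by fun_prop)).congr ?_
  rintro ⟨⟨u, v⟩, u', v'⟩ x
  simp only [cylPair, Set.mem_inter_iff, Set.mem_prod, mem_cyl, Set.mem_ofPred_eq, take_initSeg,
    Prod.mk.injEq]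
  congr! 4 <;> omega

theorem effectivelyOpen_preimage_prodMk {ω₀ : Cantor} (hω₀ : Computable (initSeg ω₀)) :
    EffectivelyOpen cyl fun j => Prod.mk ω₀ ⁻¹' cylPair j := by
  refine (effectivelyOpen_cyl_setOf_initSeg (α := List Bool × List Bool)
    (V := fun y => initSeg ω₀ y.1.1.length = y.1.1 ∧ y.2 = y.1.2)
    (rePred_and (rePred_eq (by fun_prop) (by fun_prop)) (rePred_eq (by fun_prop) (by fun_prop)))
    (n := fun j => j.2.length) (by fun_prop)).congr fun j ω => ?_
  simp [cylPair, mem_cyl]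

theorem computable_initSeg_false : Computable (initSeg fun _ => false) :=
  (Primrec.list_map Primrec.list_range (Primrec.const false).to₂).to_comp

end Cylinders

theorem two_zpow_eq (k : ℤ) :
    (2 : ℝ≥0∞) ^ k = ((2 ^ k.toNat : ℕ) : ℝ≥0∞) / ((2 ^ (-k).toNat : ℕ) : ℝ≥0∞) := by
  rcases k with k | k
  · simp
  · simp [zpow_negSucc, Int.neg_negSucc]

section LowerSemicomputable

variable {X Y ι ι' α β : Type} [Primcodable ι] [Primcodable ι'] [Primcodable α] [Primcodable β]
  {B : ι → Set X} {B' : ι' → Set Y}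

/-- The functions `f p` are lower semicomputable, uniformly in the parameter `p`. -/
def UniformlyLowerSemicomputable (B : ι → Set X) (f : α → X → ℝ≥0∞) : Prop :=
  EffectivelyOpen B fun q : α × ℕ × ℕ => {x | (q.2.1 : ℝ≥0∞) / ((q.2.2 : ℝ≥0∞) + 1) < f q.1 x}

theorem lowerSemicomputable_iff {f : X → ℝ≥0∞} :
    LowerSemicomputable B f ↔ UniformlyLowerSemicomputable B fun _ : Unit => f := by
  constructor
  · rintro ⟨W, hW, hf⟩
    exact ⟨fun y => W (y.1, y.2.2), rePred_comp hW (by fun_prop), fun p => hf p.2.1 p.2.2⟩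
  · rintro ⟨W, hW, hf⟩
    exact ⟨fun y => W (y.1, (), y.2), rePred_comp hW (by fun_prop), fun a b => hf ((), a, b)⟩

namespace UniformlyLowerSemicomputable

theorem congr {f g : α → X → ℝ≥0∞} (hf : UniformlyLowerSemicomputable B f)
    (h : ∀ p x, g p x = f p x) : UniformlyLowerSemicomputable B g := by
  rwa [show g = f from funext₂ h]

theorem comp {f : α → X → ℝ≥0∞} (hf : UniformlyLowerSemicomputable B f) {g : β → α}
    (hg : Computable g) : UniformlyLowerSemicomputable B fun p => f (g p) :=
  EffectivelyOpen.comp hf (g := fun q : β × ℕ × ℕ => (g q.1, q.2)) (by fun_prop)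

theorem lowerSemicomputable {f : α → X → ℝ≥0∞} (hf : UniformlyLowerSemicomputable B f) (p : α) :
    LowerSemicomputable B (f p) :=
  lowerSemicomputable_iff.2 (hf.comp (.const p))

theorem preimage {f : α → Y → ℝ≥0∞} (hf : UniformlyLowerSemicomputable B' f) {g : X → Y}
    (hg : EffectivelyOpen B fun j => g ⁻¹' B' j) :
    UniformlyLowerSemicomputable B fun p x => f p (g x) :=
  EffectivelyOpen.preimage hf hg

theorem iSup {f : α × β → X → ℝ≥0∞} (hf : UniformlyLowerSemicomputable B f) :
    UniformlyLowerSemicomputable B fun a x => ⨆ b, f (a, b) x := by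
  refine (EffectivelyOpen.iUnion (EffectivelyOpen.comp hf
    (g := fun y : (α × ℕ × ℕ) × β => ((y.1.1, y.2), y.1.2)) (by fun_prop))).congr fun p x => ?_
  simp [lt_iSup_iff]

theorem iSup_mem (hB : EffectivelyOpen B fun j : ι × ι => B j.1 ∩ B j.2) {f : α → X → ℝ≥0∞}
    (hf : UniformlyLowerSemicomputable B f) {A : α → Set X} (hA : EffectivelyOpen B A) :
    UniformlyLowerSemicomputable B fun p x => ⨆ (_ : x ∈ A p), f p x := by
  refine (EffectivelyOpen.inter hB (hA.comp .fst) hf).congr fun q x => ?_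
  simp [lt_iSup_iff]

theorem natCast_div_mul {f : α → X → ℝ≥0∞} (hf : UniformlyLowerSemicomputable B f) {M N : α → ℕ}
    (hM : Computable M) (hN : Computable N) (hM0 : ∀ p, M p ≠ 0) (hN0 : ∀ p, N p ≠ 0) :
    UniformlyLowerSemicomputable B fun p x => (M p : ℝ≥0∞) / N p * f p x := by
  refine (EffectivelyOpen.comp hf (g := fun q : α × ℕ × ℕ =>
    (q.1, q.2.1 * N q.1, M q.1 * (q.2.2 + 1) - 1)) (by fun_prop)).congr ?_
  rintro ⟨p, a, b⟩ x
  have hpos : 0 < M p * (b + 1) := Nat.mul_pos (Nat.pos_of_ne_zero (hM0 p)) b.succ_pos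
  have hcast : ((M p * (b + 1) - 1 : ℕ) : ℝ≥0∞) + 1 = M p * (b + 1) := by
    exact_mod_cast Nat.sub_add_cancel hpos
  have hM' : (M p : ℝ≥0∞) ≠ 0 := by exact_mod_cast hM0 p
  have hN' : (N p : ℝ≥0∞) ≠ 0 := by exact_mod_cast hN0 p
  simp only [Set.mem_ofPred_eq, hcast, ← ENNReal.mul_div_right_comm]
  push_cast
  rw [ENNReal.lt_div_iff_mul_lt (.inl hN') (.inl (by finiteness)), ← ENNReal.mul_div_right_comm,
    ENNReal.div_lt_iff (.inl (by simp)) (.inl (by finiteness)),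
    ENNReal.div_lt_iff (.inl (by simp [hM'])) (.inl (by finiteness)),
    mul_comm (M p : ℝ≥0∞), mul_assoc]

theorem two_zpow_mul {f : α → X → ℝ≥0∞} (hf : UniformlyLowerSemicomputable B f) {e : α → ℤ}
    (he : Computable e) : UniformlyLowerSemicomputable B fun p x => 2 ^ e p * f p x := by
  refine (hf.natCast_div_mul (M := fun p => 2 ^ (e p).toNat) (N := fun p => 2 ^ (-e p).toNat)
    (by fun_prop) (by fun_prop) (by simp) (by simp)).congr fun p x => ?_
  rw [two_zpow_eq]

end UniformlyLowerSemicomputable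

theorem uniformlyLowerSemicomputable_natCast_initSeg {h : α × List Bool × List Bool → ℕ}
    (hh : Computable h) {n : α → ℕ} (hn : Computable n) :
    UniformlyLowerSemicomputable cylPair fun p x =>
      (h (p, initSeg x.1 (n p), initSeg x.2 (n p)) : ℝ≥0∞) := by
  refine (effectivelyOpen_cylPair_setOf_initSeg (α := α × ℕ × ℕ)
    (V := fun y => y.1.2.1 < h (y.1.1, y.2) * (y.1.2.2 + 1))
    (rePred_lt (by fun_prop) (by fun_prop)) (n := fun q => n q.1) (by fun_prop)).congr fun q x => ?_
  simp only [Set.mem_ofPred_eq]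
  rw [ENNReal.div_lt_iff (.inl (by simp)) (.inl (by finiteness))]
  norm_cast

theorem lowerSemicomputable_cylCond_iff {f : Cantor × Cantor × ℤ → ℝ≥0∞} :
    LowerSemicomputable cylCond f ↔
      UniformlyLowerSemicomputable cylPair fun (k : ℤ) x => f (x.2, x.1, k) := by
  constructor
  · rintro ⟨W, hW, hf⟩
    refine ⟨fun y => W ((y.1.2, y.1.1, y.2.1), y.2.2), rePred_comp hW (by fun_prop), ?_⟩
    rintro ⟨k, a, b⟩ ⟨ω, ω'⟩
    simp only [Set.mem_ofPred_eq, hf, Prod.exists, cylCond, cylPair, Set.mem_prod,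
      Set.mem_singleton_iff]
    grind
  · rintro ⟨W, hW, hf⟩
    refine ⟨fun y => W ((y.1.2.1, y.1.1), y.1.2.2, y.2), rePred_comp hW (by fun_prop), ?_⟩
    rintro a b ⟨ω', ω, k⟩
    refine (hf (k, a, b) (ω, ω')).trans ?_
    simp only [Prod.exists, cylCond, cylPair, Set.mem_prod, Set.mem_singleton_iff]
    grind

end LowerSemicomputable

section Measurability

variable {X ι α : Type} [Primcodable ι] [Primcodable α] [MeasurableSpace X] {B : ι → Set X}

theorem EffectivelyOpen.measurableSet (hB : ∀ i, MeasurableSet (B i)) {A : α → Set X}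
    (hA : EffectivelyOpen B A) (p : α) : MeasurableSet (A p) := by
  obtain ⟨W, -, hA⟩ := hA
  rw [show A p = ⋃ i, ⋃ (_ : W (i, p)), B i by ext x; simp [hA]]
  exact .iUnion fun i => .iUnion fun _ => hB i

theorem exists_natCast_div_btwn {x y : ℝ≥0∞} (h : x < y) :
    ∃ a b : ℕ, x < (a : ℝ≥0∞) / ((b : ℝ≥0∞) + 1) ∧ (a : ℝ≥0∞) / ((b : ℝ≥0∞) + 1) < y := by
  obtain ⟨q, hq, hxq, hqy⟩ := ENNReal.lt_iff_exists_rat_btwn.1 h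
  lift q to ℚ≥0 using hq
  obtain ⟨b, hb⟩ := Nat.exists_eq_succ_of_ne_zero q.den_ne_zero
  have hq : ((Real.toNNReal ((q : ℚ) : ℝ) : ℝ≥0) : ℝ≥0∞) = (q.num : ℝ≥0∞) / ((b : ℝ≥0∞) + 1) := by
    have hreal : ((q : ℚ) : ℝ) = (q.num : ℝ) / ((b : ℝ) + 1) := by
      rw [NNRat.cast_def, hb]
      push_cast
      rfl
    change ENNReal.ofReal _ = _
    rw [hreal, ENNReal.ofReal_div_of_pos (by positivity), ENNReal.ofReal_add (by positivity)
      zero_le_one]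
    simp
  exact ⟨_, _, hq ▸ hxq, hq ▸ hqy⟩

theorem UniformlyLowerSemicomputable.measurable (hB : ∀ i, MeasurableSet (B i))
    {f : α → X → ℝ≥0∞} (hf : UniformlyLowerSemicomputable B f) (p : α) : Measurable (f p) := by
  refine measurable_of_Ioi fun x => ?_
  have hIoi : f p ⁻¹' Set.Ioi x = ⋃ (a : ℕ) (b : ℕ) (_ : x < (a : ℝ≥0∞) / ((b : ℝ≥0∞) + 1)),
      {y | (a : ℝ≥0∞) / ((b : ℝ≥0∞) + 1) < f p y} := by
    ext y
    simp only [Set.mem_preimage, Set.mem_Ioi, Set.mem_iUnion, Set.mem_ofPred_eq, exists_prop]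
    exact ⟨exists_natCast_div_btwn, fun ⟨a, b, h, h'⟩ => h.trans h'⟩
  rw [hIoi]
  exact .iUnion fun a => .iUnion fun b => .iUnion fun _ =>
    EffectivelyOpen.measurableSet hB hf (p, a, b)

theorem measurable_initSeg (n : ℕ) : @Measurable Cantor (List Bool) _ ⊤ fun ω => initSeg ω n := by
  let : MeasurableSpace (List Bool) := ⊤
  have hcomp : (fun ω : Cantor => initSeg ω n) =
      (fun x : Fin n → Bool => List.ofFn x) ∘ fun ω i => ω i := by
    funext ω
    apply List.ext_getElem <;> simp [initSeg]
  rw [hcomp]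
  exact (measurable_of_finite _).comp (measurable_pi_lambda _ fun i => measurable_pi_apply _)

theorem measurable_comp_initSeg {β : Type*} [MeasurableSpace β] (g : List Bool → β) (n : ℕ) :
    Measurable fun ω : Cantor => g (initSeg ω n) :=
  let : MeasurableSpace (List Bool) := ⊤
  measurable_from_top.comp (measurable_initSeg n)

theorem measurableSet_cyl (u : List Bool) : MeasurableSet (cyl u) :=
  measurableSet_setOfPred.2 (measurable_comp_initSeg (· = u) u.length)

theorem measurableSet_cylPair (p : List Bool × List Bool) : MeasurableSet (cylPair p) :=
  (measurableSet_cyl p.1).prod (measurableSet_cyl p.2)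

end Measurability

section Strings

/-- All strings of length `n`, over which the integral of a function of the prefix of length `n` is
summed. -/
def strings : ℕ → List (List Bool)
  | 0 => [[]]
  | n + 1 => (strings n).map (List.cons true) ++ (strings n).map (List.cons false)

theorem primrec_strings : Primrec strings := by
  have hcons (b : Bool) : Primrec₂ fun (_ : ℕ × List (List Bool)) (l : List Bool) => b :: l :=
    (Primrec.list_cons.comp (.const b) .snd).to₂
  refine (Primrec.nat_rec₁ [[]] (Primrec.list_append.comp (Primrec.list_map .snd (hcons true))
    (Primrec.list_map .snd (hcons false))).to₂).of_eq fun n => ?_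
  induction n with
  | zero => rfl
  | succ n ih => simp only [strings, ← ih]

theorem mem_strings {n : ℕ} {v : List Bool} : v ∈ strings n ↔ v.length = n := by
  induction n generalizing v with
  | zero => simp [strings]
  | succ n ih => rcases v with _ | ⟨_ | _, v⟩ <;> simp [strings, ih]

theorem nodup_strings (n : ℕ) : (strings n).Nodup := by
  induction n with
  | zero => simp [strings]
  | succ n ih =>
    rw [strings, List.nodup_append]
    exact ⟨ih.map List.cons_injective, ih.map List.cons_injective, by simp⟩

theorem lintegral_comp_initSeg (μ : Measure Cantor) (g : List Bool → ℝ≥0∞) (n : ℕ) :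
    ∫⁻ ω, g (initSeg ω n) ∂μ = ((strings n).map fun v => g v * μ (cyl v)).sum := by
  have hsum (ω : Cantor) : g (initSeg ω n) =
      ∑ v ∈ (strings n).toFinset, g v * (cyl v).indicator 1 ω := by
    rw [Finset.sum_eq_single (initSeg ω n)]
    · simp [mem_cyl_initSeg]
    · intro v hv hne
      have hω : ω ∉ cyl v := by
        rwa [mem_cyl, mem_strings.1 (List.mem_toFinset.1 hv), ← ne_eq, ne_comm]
      simp [hω]
    · simp [mem_strings, length_initSeg]
  have hmeas (v : List Bool) : Measurable ((cyl v).indicator (1 : Cantor → ℝ≥0∞)) :=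
    measurable_one.indicator (measurableSet_cyl v)
  simp_rw [hsum]
  rw [lintegral_finsetSum _ fun v _ => (hmeas v).const_mul _,
    ← List.sum_toFinset _ (nodup_strings n)]
  simp_rw [lintegral_const_mul _ (hmeas _), lintegral_indicator_one (measurableSet_cyl _)]

end Strings

section UniversalEnumeration

variable {α : Type} [Primcodable α]

/-- The code `c` accepts the threshold `j` for the parameter `p` within `u.length` steps, having
read prefixes of the strings `u` and `v` whose lengths are coded by some `s < u.length`. -/
def Accepts (c : Code) (p : α) (u v : List Bool) (j : ℕ) : Prop :=
  ∃ s < u.length, (c.evaln u.length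
    (encode ((u.take s.unpair.1, v.take s.unpair.2), p, j))).isSome

instance (c : Code) (p : α) (u v : List Bool) : DecidablePred (Accepts c p u v) := fun _ =>
  inferInstanceAs (Decidable (∃ s < _, _))

/-- The largest threshold accepted by the code `c` on the strings `u` and `v`. As `u` and `v` run
through the prefixes of two sequences, this is a nondecreasing sequence of natural numbers, and
every lower semicomputable function is approximated in this way up to an additive constant. -/
def level (c : Code) (p : α) (u v : List Bool) : ℕ :=
  Nat.findGreatest (Accepts c p u v) u.length

theorem primrec_level :
    Primrec fun x : (Code × α) × List Bool × List Bool => level x.1.1 x.1.2 x.2.1 x.2.2 := by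
  have hstep : PrimrecPred fun z : ℕ × ((Code × α) × List Bool × List Bool) × ℕ =>
      (z.2.1.1.1.evaln z.2.1.2.1.length (encode ((z.2.1.2.1.take z.1.unpair.1,
        z.2.1.2.2.take z.1.unpair.2), z.2.1.1.2, z.2.2))).isSome :=
    Primrec.eq.comp (Primrec.option_isSome.comp (by fun_prop)) (Primrec.const true)
  have haccepts : PrimrecPred fun y : ((Code × α) × List Bool × List Bool) × ℕ =>
      Accepts y.1.1.1 y.1.1.2 y.1.2.1 y.1.2.2 y.2 :=
    (hstep.primrecRel.exists_mem_list.comp (show Primrec fun y :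
      ((Code × α) × List Bool × List Bool) × ℕ => List.range y.1.2.1.length by fun_prop)
        Primrec.id).of_eq fun y => by simp [Accepts]
  exact Primrec.nat_findGreatest (by fun_prop) haccepts.primrecRel

@[fun_prop]
theorem computable_level {γ : Type*} [Primcodable γ] {c : γ → Code} {p : γ → α}
    {u v : γ → List Bool} (hc : Computable c) (hp : Computable p) (hu : Computable u)
    (hv : Computable v) : Computable fun x => level (c x) (p x) (u x) (v x) :=
  primrec_level.to_comp.comp ((hc.pair hp).pair (hu.pair hv))

theorem level_le (c : Code) (p : α) (u v : List Bool) : level c p u v ≤ u.length :=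
  Nat.findGreatest_le _

theorem accepts_level {c : Code} {p : α} {u v : List Bool} (h : level c p u v ≠ 0) :
    Accepts c p u v (level c p u v) :=
  Nat.findGreatest_of_ne_zero rfl h

theorem Accepts.mono {c : Code} {p : α} {ω ω' : Cantor} {m n j : ℕ} (h : m ≤ n)
    (hm : Accepts c p (initSeg ω m) (initSeg ω' m) j) :
    Accepts c p (initSeg ω n) (initSeg ω' n) j := by
  obtain ⟨s, hs, hm⟩ := hm
  rw [length_initSeg] at hs
  have hs₁ := s.unpair_left_le
  have hs₂ := s.unpair_right_le
  refine ⟨s, by rw [length_initSeg]; omega, ?_⟩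
  simp only [length_initSeg, take_initSeg, min_eq_left (hs₁.trans hs.le),
    min_eq_left (hs₂.trans hs.le), Option.isSome_iff_exists] at hm
  simp only [length_initSeg, take_initSeg, min_eq_left (hs₁.trans (hs.le.trans h)),
    min_eq_left (hs₂.trans (hs.le.trans h)), Option.isSome_iff_exists]
  exact hm.imp fun y => Code.evaln_mono h

theorem monotone_level (c : Code) (p : α) (ω ω' : Cantor) :
    Monotone fun n => level c p (initSeg ω n) (initSeg ω' n) := by
  intro m n h
  refine Nat.findGreatest_mono (fun j => Accepts.mono h) ?_
  simpa only [length_initSeg] using h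

theorem exists_code_accepts {A : α × ℕ → Set (Cantor × Cantor)} (hA : EffectivelyOpen cylPair A) :
    ∃ c : Code, ∀ p ω ω' j, (ω, ω') ∈ A (p, j) ↔
      ∃ n, Accepts c p (initSeg ω n) (initSeg ω' n) j := by
  obtain ⟨W, hW, hA⟩ := hA
  obtain ⟨c, hc⟩ := exists_code_of_rePred hW
  refine ⟨c, fun p ω ω' j => ?_⟩
  simp only [hA, hc, Accepts, length_initSeg, take_initSeg]
  constructor
  · rintro ⟨⟨u, v⟩, ⟨s, hs⟩, hω, hω'⟩
    set z := Nat.pair u.length v.length with hz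
    have hu : u.length ≤ z := Nat.left_le_pair _ _
    have hv : v.length ≤ z := Nat.right_le_pair _ _
    refine ⟨max s (z + 1), z, by omega, ?_⟩
    rw [hz, Nat.unpair_pair, min_eq_left (by omega), min_eq_left (by omega), mem_cyl.1 hω,
      mem_cyl.1 hω']
    exact Option.isSome_of_mem (Code.evaln_mono (le_max_left _ _) (Option.get_mem hs))
  · rintro ⟨n, s, -, hs⟩
    exact ⟨_, ⟨n, hs⟩, mem_cyl_initSeg _ _, mem_cyl_initSeg _ _⟩

theorem exists_code_le_iSup_level_le {f : α → Cantor × Cantor → ℝ≥0∞}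
    (hf : UniformlyLowerSemicomputable cylPair f) :
    ∃ c : Code, ∀ p ω ω', f p (ω, ω') ≤ ⨆ n, (level c p (initSeg ω n) (initSeg ω' n) : ℝ≥0∞) ∧
      ∀ n, (level c p (initSeg ω n) (initSeg ω' n) : ℝ≥0∞) ≤ f p (ω, ω') + 1 := by
  obtain ⟨c, hc⟩ := exists_code_accepts (EffectivelyOpen.comp hf
    (g := fun q : α × ℕ => (q.1, q.2 - 1, 0)) (by fun_prop))
  simp only [Set.mem_ofPred_eq, Nat.cast_zero, zero_add, div_one] at hc
  refine ⟨c, fun p ω ω' => ⟨le_of_forall_lt fun y hy => ?_, fun n => ?_⟩⟩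
  · obtain ⟨j, hyj, hjf⟩ : ∃ j : ℕ, y < j ∧ ((j - 1 : ℕ) : ℝ≥0∞) < f p (ω, ω') := by
      lift y to ℝ≥0 using hy.ne_top
      have hfloor : ((⌊y⌋₊ : ℝ≥0) : ℝ≥0∞) ≤ y := by exact_mod_cast Nat.floor_le (zero_le (a := y))
      exact ⟨⌊y⌋₊ + 1, by exact_mod_cast Nat.lt_floor_add_one y,
        lt_of_le_of_lt (by simpa using hfloor) hy⟩
    obtain ⟨n, hn⟩ := (hc p ω ω' j).1 hjf
    refine hyj.trans_le (le_iSup_of_le (max n j) ?_)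
    exact_mod_cast Nat.le_findGreatest (by simp [length_initSeg]) (hn.mono (le_max_left _ _))
  · set j := level c p (initSeg ω n) (initSeg ω' n)
    rcases eq_or_ne j 0 with h0 | h0
    · simp [h0]
    · have hlt := (hc p ω ω' j).2 ⟨n, accepts_level h0⟩
      calc (j : ℝ≥0∞) = ((j - 1 : ℕ) : ℝ≥0∞) + 1 := by
            exact_mod_cast (Nat.sub_add_cancel (Nat.pos_of_ne_zero h0)).symm
        _ ≤ f p (ω, ω') + 1 := by gcongr

end UniversalEnumeration

theorem exists_two_pow_mul_add_lt {x y c : ℝ≥0∞} (h : x < y) (hc : c ≠ ⊤) :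
    ∃ m : ℕ, 2 ^ m * x + c < 2 ^ m * y := by
  obtain ⟨z, hxz, hzy⟩ := ENNReal.lt_iff_exists_nnreal_btwn.1 h
  lift x to ℝ≥0 using h.ne_top
  lift c to ℝ≥0 using hc
  have hxz : (0 : ℝ) < z - x := sub_pos.2 (by exact_mod_cast hxz)
  obtain ⟨m, hm⟩ := pow_unbounded_of_one_lt ((c : ℝ) / (z - x)) one_lt_two
  refine ⟨m, lt_of_lt_of_le (b := 2 ^ m * (z : ℝ≥0∞)) ?_ (by gcongr)⟩
  have hm : (2 : ℝ) ^ m * x + c < 2 ^ m * z := by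
    rw [div_lt_iff₀ hxz] at hm
    linarith
  exact_mod_cast hm

section ComputableSums

variable {α β : Type*} [Primcodable α] [Primcodable β]

theorem computable_nat_min {f g : α → ℕ} (hf : Computable f) (hg : Computable g) :
    Computable fun a => min (f a) (g a) :=
  Primrec.nat_min.to_comp.comp hf hg

theorem computable_list_sum_map {l : α → List β} (hl : Computable l) {g : α × β → ℕ}
    (hg : Computable g) : Computable fun a => ((l a).map fun b => g (a, b)).sum := by
  have hterm : Computable fun y : α × ℕ × ℕ =>
      (((l y.1)[y.2.1]?).map fun b => g (y.1, b)).getD 0 :=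
    Computable.option_getD (Computable.option_map (Computable.list_getElem?.comp
      (hl.comp .fst) (by fun_prop)) (hg.comp
        (g := fun z : (α × ℕ × ℕ) × β => (z.1.1, z.2)) (by fun_prop)).to₂) (.const 0)
  have hrec := Computable.nat_rec (Computable.list_length.comp hl) (Computable.const 0)
    (h := fun a y => y.2 + (((l a)[y.1]?).map fun b => g (a, b)).getD 0)
    (computable_nat_add (f := fun y : α × ℕ × ℕ => y.2.2) (by fun_prop) hterm).to₂
  refine hrec.of_eq fun a => ?_
  suffices h : ∀ n, (Nat.rec 0 (fun i r => r + (((l a)[i]?).map fun b => g (a, b)).getD 0) n : ℕ) =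
      (((l a).take n).map fun b => g (a, b)).sum by
    rw [h, List.take_length]
  intro n
  induction n with
  | zero => simp
  | succ n ih =>
    simp only [ih, List.take_add_one, List.map_append, List.sum_append]
    cases (l a)[n]? <;> simp

end ComputableSums

theorem list_sum_lt_natCast_iff {β : Type*} (l : List β) (g : β → ℕ) {x : β → ℝ≥0∞}
    {U : ℕ → ℕ → β → ℕ} (hle : ∀ m s v, 2 ^ m * x v ≤ U m s v)
    (hge : ∀ m v, ∀ᶠ s in Filter.atTop, (U m s v : ℝ≥0∞) ≤ 2 ^ m * x v + 2) (L : ℕ) :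
    (l.map fun v => g v * x v).sum < L ↔ ∃ m s, (l.map fun v => g v * U m s v).sum < L * 2 ^ m := by
  have hcast (m s) : (((l.map fun v => g v * U m s v).sum : ℕ) : ℝ≥0∞) =
      (l.map fun v => (g v : ℝ≥0∞) * U m s v).sum := by
    simp [Nat.cast_list_sum, Function.comp_def]
  constructor
  · intro h
    obtain ⟨m, hm⟩ := exists_two_pow_mul_add_lt h
      (ENNReal.natCast_ne_top (l.map fun v => g v * 2).sum)
    have hge : ∀ᶠ s in Filter.atTop, ∀ v ∈ l, (U m s v : ℝ≥0∞) ≤ 2 ^ m * x v + 2 :=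
      (Filter.eventually_all_finite l.finite_toSet).2 fun v _ => hge m v
    obtain ⟨s, hs⟩ := hge.exists
    refine ⟨m, s, ?_⟩
    rw [← Nat.cast_lt (α := ℝ≥0∞), hcast]
    calc (l.map fun v => (g v : ℝ≥0∞) * U m s v).sum
        ≤ (l.map fun v => 2 ^ m * (g v * x v) + (g v * 2 : ℕ)).sum := by
          refine List.sum_le_sum fun v hv => ?_
          grw [hs v hv]
          push_cast
          exact (by ring : (g v : ℝ≥0∞) * (2 ^ m * x v + 2) = _).le
      _ = 2 ^ m * (l.map fun v => g v * x v).sum + ((l.map fun v => g v * 2).sum : ℕ) := by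
          rw [List.sum_map_add, List.sum_map_mul_left]
          simp [Nat.cast_list_sum, Function.comp_def]
      _ < (L * 2 ^ m : ℕ) := by rwa [Nat.cast_mul, mul_comm (L : ℝ≥0∞), Nat.cast_pow]
  · rintro ⟨m, s, h⟩
    rw [← Nat.cast_lt (α := ℝ≥0∞), hcast, Nat.cast_mul, mul_comm (L : ℝ≥0∞), Nat.cast_pow] at h
    refine lt_of_mul_lt_mul_left' (a := 2 ^ m) (lt_of_le_of_lt ?_ h)
    rw [← List.sum_map_mul_left]
    refine List.sum_le_sum fun v _ => ?_
    grw [← hle m s v]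
    exact (by ring : _ = (g v : ℝ≥0∞) * (2 ^ m * x v)).le

section RunningMin

/-- The minimum of `M` and of the first `k` values of `f`. If the values of `f` are upper bounds of
which one is good, the running minima are good upper bounds from some moment on, so that finitely
many bounds can be waited for simultaneously. -/
def runningMin (M : ℕ) (f : ℕ → ℕ) : ℕ → ℕ
  | 0 => M
  | k + 1 => min (runningMin M f k) (f k)

theorem computable_runningMin {α : Type*} [Primcodable α] {M : α → ℕ} (hM : Computable M)
    {f : α × ℕ → ℕ} (hf : Computable f) {k : α → ℕ} (hk : Computable k) :
    Computable fun a => runningMin (M a) (fun z => f (a, z)) (k a) := by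
  refine (Computable.nat_rec hk hM (h := fun a y => min y.2 (f (a, y.1)))
    (computable_nat_min (f := fun y : α × ℕ × ℕ => y.2.2) (by fun_prop)
      (hf.comp (g := fun y : α × ℕ × ℕ => (y.1, y.2.1))
        (by fun_prop))).to₂).of_eq fun a => ?_
  induction k a with
  | zero => rfl
  | succ k ih => simp only [runningMin, ih]

theorem le_runningMin {M : ℕ} {f : ℕ → ℕ} {x : ℝ≥0∞} (hM : x ≤ M) (hf : ∀ z, x ≤ f z) (k : ℕ) :
    x ≤ runningMin M f k := by
  induction k with
  | zero => exact hM
  | succ k ih =>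
    rw [runningMin]
    rcases min_choice (runningMin M f k) (f k) with h | h <;> rw [h]
    exacts [ih, hf k]

theorem runningMin_le (M : ℕ) (f : ℕ → ℕ) {z k : ℕ} (h : z < k) : runningMin M f k ≤ f z := by
  induction k, h using Nat.le_induction with
  | base => exact min_le_right _ _
  | succ k _ ih => exact (min_le_left _ _).trans ih

end RunningMin

theorem two_pow_mul_bounds {x : ℝ≥0∞} (hx : x ≠ ⊤) {a m : ℕ}
    (h : |x.toReal - (a : ℝ) / 2 ^ m| ≤ 1 / 2 ^ m) :
    2 ^ m * x ≤ (a + 1 : ℕ) ∧ ((a + 1 : ℕ) : ℝ≥0∞) ≤ 2 ^ m * x + 2 := by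
  lift x to ℝ≥0 using hx
  have hscaled : |2 ^ m * (x : ℝ) - a| ≤ 1 := by
    have hpow : (0 : ℝ) < 2 ^ m := by positivity
    rw [le_div_iff₀ hpow, ← abs_of_pos hpow, ← abs_mul, abs_of_pos hpow] at h
    rwa [ENNReal.coe_toReal, sub_mul, div_mul_cancel₀ _ hpow.ne', mul_comm (x : ℝ)] at h
  obtain ⟨hlow, hup⟩ := abs_le.1 hscaled
  constructor
  · exact_mod_cast (by push_cast; linarith : (2 : ℝ) ^ m * x ≤ (a + 1 : ℕ))
  · exact_mod_cast (by push_cast; linarith : ((a + 1 : ℕ) : ℝ) ≤ 2 ^ m * x + 2)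

section Integration

variable {α : Type} [Primcodable α] {κ : Kernel Cantor Cantor} [IsMarkovKernel κ]

theorem exists_computable_upper_bound (hκ : IsUniformlyComputable κ) :
    ∃ U : List Bool × List Bool × ℕ → ℕ, Computable U ∧ ∀ ω v m,
      (∀ s, 2 ^ m * κ ω (cyl v) ≤ U (initSeg ω s, v, m)) ∧
      ∃ s, (U (initSeg ω s, v, m) : ℝ≥0∞) ≤ 2 ^ m * κ ω (cyl v) + 2 := by
  obtain ⟨Φ, hΦ, hκ⟩ := hκ
  refine ⟨fun y => ((Φ y.1 y.2).map (· + 1)).getD (2 ^ y.2.2), Computable.option_getD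
    (Computable.option_map (hΦ.comp .fst .snd) (show Computable fun z :
      (List Bool × List Bool × ℕ) × ℕ => z.2 + 1 by fun_prop).to₂) (by fun_prop),
    fun ω v m => ⟨fun s => ?_, ?_⟩⟩
  · rcases hs : Φ (initSeg ω s) (v, m) with _ | a
    · simpa [hs] using mul_le_of_le_one_right' prob_le_one
    · simpa [hs] using (two_pow_mul_bounds (measure_ne_top _ _) ((hκ ω v m).2 s a hs)).1
  · obtain ⟨⟨s, a, hs⟩, happrox⟩ := hκ ω v m
    exact ⟨s, by simpa [hs] using (two_pow_mul_bounds (measure_ne_top _ _) (happrox s a hs)).2⟩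

theorem exists_computable_upper_bound_eventually (hκ : IsUniformlyComputable κ) :
    ∃ U : List Bool × List Bool × ℕ → ℕ, Computable U ∧ ∀ ω v m,
      (∀ s, 2 ^ m * κ ω (cyl v) ≤ U (initSeg ω s, v, m)) ∧
      ∀ᶠ s in Filter.atTop, (U (initSeg ω s, v, m) : ℝ≥0∞) ≤ 2 ^ m * κ ω (cyl v) + 2 := by
  obtain ⟨U, hU, hκU⟩ := exists_computable_upper_bound hκ
  have hmin := computable_runningMin (M := fun y : List Bool × List Bool × ℕ => 2 ^ y.2.2)
    (by fun_prop) (f := fun z => U (z.1.1.take z.2, z.1.2)) (by fun_prop)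
    (k := fun y => y.1.length + 1) (by fun_prop)
  refine ⟨_, hmin, fun ω v m => ⟨fun s => ?_, ?_⟩⟩
  · refine le_runningMin ?_ (fun z => ?_) _
    · simpa using mul_le_of_le_one_right' prob_le_one
    · simpa only [take_initSeg] using (hκU ω v m).1 _
  · obtain ⟨z, hz⟩ := (hκU ω v m).2
    filter_upwards [Filter.eventually_ge_atTop z] with s hs
    refine le_trans (Nat.cast_le.2 ((runningMin_le _ _ (z := z) ?_).trans_eq ?_)) hz
    · simpa [length_initSeg] using Nat.lt_succ_of_le hs
    · rw [take_initSeg, min_eq_left hs]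

theorem effectivelyOpen_setOf_lintegral_lt (hκ : IsUniformlyComputable κ)
    {h : α × List Bool × List Bool → ℕ} (hh : Computable h) {n L : α → ℕ} (hn : Computable n)
    (hL : Computable L) : EffectivelyOpen cyl fun p =>
      {ω | ∫⁻ ω', (h (p, initSeg ω (n p), initSeg ω' (n p)) : ℝ≥0∞) ∂κ ω < L p} := by
  obtain ⟨U, hU, hκU⟩ := exists_computable_upper_bound_eventually hκ
  have hsum : Computable fun y : (α × ℕ × ℕ) × List Bool => ((strings (n y.1.1)).map fun v =>
      h (y.1.1, y.2.take (n y.1.1), v) * U (y.2, v, y.1.2.1)).sum :=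
    computable_list_sum_map (primrec_strings.to_comp.comp (by fun_prop))
      (g := fun z : ((α × ℕ × ℕ) × List Bool) × List Bool =>
        h (z.1.1.1, z.1.2.take (n z.1.1.1), z.2) * U (z.1.2, z.2, z.1.1.2.1)) (by fun_prop)
  refine (EffectivelyOpen.iUnion (effectivelyOpen_cyl_setOf_initSeg (α := α × ℕ × ℕ)
    (V := fun y => _ < L y.1.1 * 2 ^ y.1.2.1) (rePred_lt hsum (by fun_prop))
    (n := fun y => y.2.2 + n y.1) (by fun_prop))).congr fun p ω => ?_
  simp only [Set.mem_ofPred_eq, Set.mem_iUnion, Prod.exists, take_initSeg,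
    min_eq_left (Nat.le_add_left _ _), lintegral_comp_initSeg _
      fun v => (h (p, initSeg ω (n p), v) : ℝ≥0∞)]
  exact list_sum_lt_natCast_iff _ _ (fun m s v => (hκU ω v m).1 _) (fun m v =>
    (Filter.tendsto_add_atTop_nat (n p)).eventually (hκU ω v m).2) _

theorem natCast_lt_lintegral_iff {Ω : Type*} [MeasurableSpace Ω] (μ : Measure Ω)
    [IsProbabilityMeasure μ] {g : Ω → ℕ} (hg : Measurable fun x => (g x : ℝ≥0∞)) {M : ℕ}
    (hM : ∀ x, g x ≤ M) (A : ℕ) :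
    (A : ℝ≥0∞) < ∫⁻ x, g x ∂μ ↔ ∫⁻ x, ((M - g x : ℕ) : ℝ≥0∞) ∂μ < (M - A : ℕ) := by
  have hadd : ∫⁻ x, ((M - g x : ℕ) : ℝ≥0∞) ∂μ + ∫⁻ x, g x ∂μ = M := by
    rw [← lintegral_add_right _ hg]
    simp_rw [← Nat.cast_add, Nat.sub_add_cancel (hM _)]
    simp
  have hfin : ∫⁻ x, ((M - g x : ℕ) : ℝ≥0∞) ∂μ ≠ ⊤ :=
    ne_top_of_le_ne_top (ENNReal.natCast_ne_top M) (hadd ▸ le_self_add)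
  rw [ENNReal.natCast_sub, lt_tsub_iff_right, ← hadd, ENNReal.add_lt_add_iff_left hfin]

theorem effectivelyOpen_setOf_lt_lintegral (hκ : IsUniformlyComputable κ)
    {h : α × List Bool × List Bool → ℕ} (hh : Computable h) {n A M : α → ℕ} (hn : Computable n)
    (hA : Computable A) (hM : Computable M)
    (hle : ∀ p ω ω', h (p, initSeg ω (n p), initSeg ω' (n p)) ≤ M p) :
    EffectivelyOpen cyl fun p =>
      {ω | (A p : ℝ≥0∞) < ∫⁻ ω', h (p, initSeg ω (n p), initSeg ω' (n p)) ∂κ ω} :=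
  (effectivelyOpen_setOf_lintegral_lt hκ (h := fun y => M y.1 - h y) (L := fun p => M p - A p)
    (by fun_prop) hn (by fun_prop)).congr fun p ω =>
      natCast_lt_lintegral_iff _ (measurable_comp_initSeg
        (fun v => (h (p, initSeg ω (n p), v) : ℝ≥0∞)) _) (hle p ω) _

theorem lt_lintegral_iff_exists_two_pow_mul_add_one_lt {Ω : Type*} [MeasurableSpace Ω]
    (μ : Measure Ω) [IsProbabilityMeasure μ] {f : Ω → ℝ≥0∞} {g : ℕ → ℕ → Ω → ℝ≥0∞}
    (hmeas : ∀ j n, Measurable (g j n)) (hmono : ∀ j, Monotone (g j))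
    (hle : ∀ j x, 2 ^ j * f x ≤ ⨆ n, g j n x) (hge : ∀ j n x, g j n x ≤ 2 ^ j * f x + 1)
    (q : ℝ≥0∞) : q < ∫⁻ x, f x ∂μ ↔ ∃ j n, 2 ^ j * q + 1 < ∫⁻ x, g j n x ∂μ := by
  have hpow (j : ℕ) : (2 : ℝ≥0∞) ^ j ≠ ⊤ := by finiteness
  constructor
  · intro h
    obtain ⟨j, hj⟩ := exists_two_pow_mul_add_lt h ENNReal.one_ne_top
    refine ⟨j, lt_iSup_iff.1 (hj.trans_le ?_)⟩
    rw [← lintegral_const_mul' _ _ (hpow j), ← lintegral_iSup (hmeas j) (hmono j)]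
    exact lintegral_mono (hle j)
  · rintro ⟨j, n, h⟩
    have hint : ∫⁻ x, g j n x ∂μ ≤ 2 ^ j * ∫⁻ x, f x ∂μ + 1 := by
      calc ∫⁻ x, g j n x ∂μ ≤ ∫⁻ x, (2 ^ j * f x + 1) ∂μ := lintegral_mono (hge j n)
        _ = 2 ^ j * ∫⁻ x, f x ∂μ + 1 := by
          rw [lintegral_add_right _ measurable_const, lintegral_const_mul' _ _ (hpow j)]
          simp
    exact lt_of_mul_lt_mul_left' (lt_of_add_lt_add_right (h.trans_le hint))

theorem UniformlyLowerSemicomputable.lintegral_kernel (hκ : IsUniformlyComputable κ)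
    {f : α → Cantor × Cantor → ℝ≥0∞} (hf : UniformlyLowerSemicomputable cylPair f) :
    UniformlyLowerSemicomputable cyl fun p ω => ∫⁻ ω', f p (ω, ω') ∂κ ω := by
  -- Levels approximate only up to an additive `1`, which the scaling by `2 ^ j` makes negligible.
  obtain ⟨c, hc⟩ := exists_code_le_iSup_level_le ((hf.comp .fst).natCast_div_mul
    (M := fun y : α × ℕ => 2 ^ y.2) (N := fun _ => 1) (by fun_prop) (by fun_prop) (by simp)
    (by simp))
  refine (EffectivelyOpen.iUnion (effectivelyOpen_setOf_lt_lintegral hκ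
    (α := (α × ℕ × ℕ) × ℕ × ℕ) (h := fun y => (y.1.1.2.2 + 1) *
      level c (y.1.1.1, y.1.2.1) y.2.1 y.2.2)
    (A := fun y => 2 ^ y.2.1 * y.1.2.1 + (y.1.2.2 + 1)) (M := fun y => (y.1.2.2 + 1) * y.2.2)
    (n := fun y => y.2.2) (by fun_prop) (by fun_prop) (by fun_prop) (by fun_prop)
    fun y ω ω' => Nat.mul_le_mul_left _ ((level_le _ _ _ _).trans_eq (length_initSeg _ _)))).congr
      ?_
  rintro ⟨p, a, b⟩ ω
  have hb : ((b : ℝ≥0∞) + 1) ≠ 0 := by simp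
  simp only [Nat.cast_pow, Nat.cast_ofNat, Nat.cast_one, div_one] at hc
  simp only [Set.mem_ofPred_eq, Set.mem_iUnion, Prod.exists]
  rw [lt_lintegral_iff_exists_two_pow_mul_add_one_lt (κ ω)
    (g := fun j n ω' => (level c (p, j) (initSeg ω n) (initSeg ω' n) : ℝ≥0∞))
    (fun j n => measurable_comp_initSeg (fun v => (level c (p, j) (initSeg ω n) v : ℝ≥0∞)) n)
    (fun j m n h ω' => Nat.cast_le.2 (monotone_level c (p, j) ω ω' h))
    (fun j ω' => (hc (p, j) ω ω').1) (fun j n ω' => (hc (p, j) ω ω').2 n)]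
  refine exists₂_congr fun j n => ?_
  push_cast
  rw [lintegral_const_mul' _ _ (by finiteness), ← ENNReal.mul_lt_mul_iff_right hb (by finiteness),
    mul_add, mul_one, mul_left_comm, ENNReal.mul_div_cancel hb (by finiteness)]

/-- The part of the function enumerated by the code `c` that consists of its levels with integrals
less than `3` over the second component. For the code of a test nothing is cut off: its levels have
integrals at most `2`, because they exceed the test by at most `1`. -/
noncomputable def trim (κ : Kernel Cantor Cantor) (c : Code) (p : α) (x : Cantor × Cantor) :
    ℝ≥0∞ :=
  ⨆ n, ⨆ (_ : ∫⁻ ω', (level c p (initSeg x.1 n) (initSeg ω' n) : ℝ≥0∞) ∂κ x.1 < 3),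
    (level c p (initSeg x.1 n) (initSeg x.2 n) : ℝ≥0∞)

theorem uniformlyLowerSemicomputable_trim (hκ : IsUniformlyComputable κ) :
    UniformlyLowerSemicomputable cylPair fun y : Code × α => trim κ y.1 y.2 := by
  have hlevel : Computable fun z : ((Code × α) × ℕ) × List Bool × List Bool =>
      level z.1.1.1 z.1.1.2 z.2.1 z.2.2 := by fun_prop
  have hsmall := effectivelyOpen_setOf_lintegral_lt hκ hlevel (n := Prod.snd) (L := fun _ => 3)
    (by fun_prop) (by fun_prop)
  exact ((uniformlyLowerSemicomputable_natCast_initSeg hlevel (n := Prod.snd)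
    (by fun_prop)).iSup_mem effectivelyOpen_cylPair_inter
      (hsmall.preimage effectivelyOpen_preimage_fst)).iSup

theorem lintegral_trim_le (κ : Kernel Cantor Cantor) (c : Code) (p : α) (ω : Cantor) :
    ∫⁻ ω', trim κ c p (ω, ω') ∂κ ω ≤ 3 := by
  simp only [trim, iSup_subtype']
  rw [lintegral_iSup_directed]
  · exact iSup_le fun n => n.2.le
  · exact fun n => (measurable_comp_initSeg
      (fun v => (level c p (initSeg ω n) v : ℝ≥0∞)) n).aemeasurable
  · exact Monotone.directed_le fun m n h ω' => Nat.cast_le.2 (monotone_level c p ω ω' h)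

theorem UniformlyLowerSemicomputable.exists_code_le_trim (κ : Kernel Cantor Cantor)
    [IsMarkovKernel κ] {f : α → Cantor × Cantor → ℝ≥0∞}
    (hf : UniformlyLowerSemicomputable cylPair f) :
    ∃ c : Code, ∀ p ω, ∫⁻ ω', f p (ω, ω') ∂κ ω ≤ 1 → ∀ ω', f p (ω, ω') ≤ trim κ c p (ω, ω') := by
  obtain ⟨c, hc⟩ := exists_code_le_iSup_level_le hf
  refine ⟨c, fun p ω h ω' => (hc p ω ω').1.trans (iSup_mono fun n => le_iSup_of_le ?_ le_rfl)⟩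
  calc ∫⁻ ω', (level c p (initSeg ω n) (initSeg ω' n) : ℝ≥0∞) ∂κ ω
      ≤ ∫⁻ ω', (f p (ω, ω') + 1) ∂κ ω := lintegral_mono fun ω' => (hc p ω ω').2 n
    _ = ∫⁻ ω', f p (ω, ω') ∂κ ω + 1 := by rw [lintegral_add_right _ measurable_const]; simp
    _ ≤ 1 + 1 := by gcongr
    _ < 3 := by norm_num

end Integration

section MaximalTests

variable {κ : Kernel Cantor Cantor} [IsMarkovKernel κ]

/-- A maximal conditional test: the weighted supremum of the trimmed functions of all codes. -/
noncomputable def universalCondTest (κ : Kernel Cantor Cantor) (y : Cantor × Cantor × ℤ) : ℝ≥0∞ :=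
  ⨆ c : Code, (2 ^ (encode c + 3))⁻¹ * trim κ c y.2.2 (y.2.1, y.1)

theorem lintegral_universalCondTest_le_one (hκ : IsUniformlyComputable κ) (ω : Cantor) (k : ℤ) :
    ∫⁻ ω', universalCondTest κ (ω', ω, k) ∂κ ω ≤ 1 := by
  have hmeas (c : Code) : Measurable fun ω' => trim κ c k (ω, ω') :=
    ((uniformlyLowerSemicomputable_trim hκ).measurable measurableSet_cylPair (c, k)).comp
      measurable_prodMk_left
  calc ∫⁻ ω', universalCondTest κ (ω', ω, k) ∂κ ω
      ≤ ∫⁻ ω', ∑' c : Code, (2 ^ (encode c + 3))⁻¹ * trim κ c k (ω, ω') ∂κ ω :=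
        lintegral_mono fun ω' => iSup_le fun c => ENNReal.le_tsum (f := fun c : Code =>
          (2 ^ (encode c + 3))⁻¹ * trim κ c k (ω, ω')) c
    _ = ∑' c : Code, (2 ^ (encode c + 3))⁻¹ * ∫⁻ ω', trim κ c k (ω, ω') ∂κ ω := by
        rw [lintegral_tsum fun c => ((hmeas c).const_mul _).aemeasurable]
        simp_rw [lintegral_const_mul _ (hmeas _)]
    _ ≤ ∑' c : Code, (1 / 2) ^ encode c * (2 ^ 3)⁻¹ * 3 := by
        refine ENNReal.tsum_le_tsum fun c => mul_le_mul' (le_of_eq ?_) (lintegral_trim_le κ c k ω)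
        rw [pow_add, ENNReal.mul_inv (by simp) (by simp), one_div, ENNReal.inv_pow]
    _ ≤ 2 * (2 ^ 3)⁻¹ * 3 := by
        rw [ENNReal.tsum_mul_right, ENNReal.tsum_mul_right]
        gcongr
        simpa using ENNReal.tsum_geometric_two_encode_le_two (ι := Code)
    _ ≤ 1 := by
        rw [mul_right_comm, ← div_eq_mul_inv]
        exact ENNReal.div_le_of_le_mul (by norm_num)

theorem isCondTest_universalCondTest (hκ : IsUniformlyComputable κ) :
    IsCondTest κ (universalCondTest κ) := by
  refine ⟨lowerSemicomputable_cylCond_iff.2 ?_, lintegral_universalCondTest_le_one hκ⟩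
  refine (((uniformlyLowerSemicomputable_trim (α := ℤ) hκ).comp (β := ℤ × Code)
    (g := fun y => (y.2, y.1)) (by fun_prop)).natCast_div_mul (M := fun _ => 1)
      (N := fun y => 2 ^ (encode y.2 + 3)) (by fun_prop) (by fun_prop) (by simp)
      (by simp)).iSup.congr fun k x => ?_
  simp [universalCondTest]

theorem UniformlyLowerSemicomputable.exists_le_mul_universalCondTest (κ : Kernel Cantor Cantor)
    [IsMarkovKernel κ] {f : ℤ → Cantor × Cantor → ℝ≥0∞}
    (hf : UniformlyLowerSemicomputable cylPair f) :
    ∃ C : ℝ≥0, ∀ k ω, ∫⁻ ω', f k (ω, ω') ∂κ ω ≤ 1 →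
      ∀ ω', f k (ω, ω') ≤ C * universalCondTest κ (ω', ω, k) := by
  obtain ⟨c, hc⟩ := hf.exists_code_le_trim κ
  refine ⟨2 ^ (encode c + 3), fun k ω h ω' => (hc k ω h ω').trans ?_⟩
  push_cast
  rw [← ENNReal.inv_mul_le_iff (by simp) (by simp)]
  exact le_iSup_of_le c le_rfl

theorem exists_isMaximalCondTest (hκ : IsUniformlyComputable κ) : ∃ t, IsMaximalCondTest κ t := by
  refine ⟨universalCondTest κ, isCondTest_universalCondTest hκ, fun s hs => ?_⟩
  obtain ⟨C, hC⟩ := (lowerSemicomputable_cylCond_iff.1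
    hs.lowerSemicomputable).exists_le_mul_universalCondTest κ
  exact ⟨C, fun y => hC y.2.2 y.2.1 (hs.lintegral_le_one _ _) y.1⟩

theorem exists_le_two_pow (C : ℝ≥0) : ∃ n : ℕ, (C : ℝ≥0∞) ≤ 2 ^ n := by
  obtain ⟨n, hn⟩ := pow_unbounded_of_one_lt C one_lt_two
  exact ⟨n, by exact_mod_cast hn.le⟩

theorem IsMaximalCondTest.exists_le_two_pow_mul (hκ : IsUniformlyComputable κ)
    {t₂ : Cantor × Cantor × ℤ → ℝ≥0∞} (ht₂ : IsMaximalCondTest κ t₂)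
    {f : ℤ → Cantor × Cantor → ℝ≥0∞} (hf : UniformlyLowerSemicomputable cylPair f) :
    ∃ n : ℕ, ∀ k ω, ∫⁻ ω', f k (ω, ω') ∂κ ω ≤ 1 →
      ∀ ω', f k (ω, ω') ≤ 2 ^ n * t₂ (ω', ω, k) := by
  obtain ⟨C, hC⟩ := hf.exists_le_mul_universalCondTest κ
  obtain ⟨C', hC'⟩ := ht₂.maximal _ (isCondTest_universalCondTest hκ)
  obtain ⟨n, hn⟩ := exists_le_two_pow (C * C')
  refine ⟨n, fun k ω h ω' => ?_⟩
  calc f k (ω, ω') ≤ C * universalCondTest κ (ω', ω, k) := hC k ω h ω'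
    _ ≤ C * (C' * t₂ (ω', ω, k)) := by gcongr; exact hC' _
    _ ≤ 2 ^ n * t₂ (ω', ω, k) := by
        rw [← mul_assoc]
        gcongr
        exact_mod_cast hn

theorem IsMaximalTest.exists_le_two_pow_mul {X ι : Type} [Primcodable ι] [MeasurableSpace X]
    {B : ι → Set X} {μ : Measure X} {t s : X → ℝ≥0∞} (ht : IsMaximalTest B μ t)
    (hs : IsTest B μ s) : ∃ n : ℕ, ∀ x, s x ≤ 2 ^ n * t x := by
  obtain ⟨C, hC⟩ := ht.maximal s hs
  obtain ⟨n, hn⟩ := exists_le_two_pow C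
  exact ⟨n, fun x => (hC x).trans (by gcongr)⟩

theorem IsComputableMeasure.isUniformlyComputable_const {μ : Measure Cantor}
    (hμ : IsComputableMeasure μ) : IsUniformlyComputable (Kernel.const Cantor μ) := by
  obtain ⟨A, hA, hμ⟩ := hμ
  exact ⟨fun _ y => some (A y.1 y.2), (Computable.option_some.comp
    (hA.comp (Computable.fst.comp .snd) (Computable.snd.comp .snd))).to₂,
    fun ω v n => ⟨⟨0, _, rfl⟩, by simpa using hμ v n⟩⟩

theorem exists_isMaximalTest {μ : Measure Cantor} [IsProbabilityMeasure μ]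
    (hμ : IsComputableMeasure μ) : ∃ t, IsMaximalTest cyl μ t := by
  obtain ⟨t₂, ht₂⟩ := exists_isMaximalCondTest hμ.isUniformlyComputable_const
  refine ⟨fun ω => t₂ (ω, fun _ => false, 0), ⟨?_, ?_⟩, fun s hs => ?_⟩
  · exact ((lowerSemicomputable_cylCond_iff.1 ht₂.isCondTest.lowerSemicomputable).preimage
      (effectivelyOpen_preimage_prodMk computable_initSeg_false)).lowerSemicomputable 0
  · simpa using ht₂.isCondTest.lintegral_le_one (fun _ => false) 0
  · have hs' : IsCondTest (Kernel.const Cantor μ) fun y => s y.1 := by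
      refine ⟨lowerSemicomputable_cylCond_iff.2 ?_, fun ω k => by simpa using hs.lintegral_le_one⟩
      exact ((lowerSemicomputable_iff.1 hs.lowerSemicomputable).preimage
        effectivelyOpen_preimage_snd).comp (.const ())
    obtain ⟨C, hC⟩ := ht₂.maximal _ hs'
    exact ⟨C, fun ω => hC (ω, fun _ => false, 0)⟩

end MaximalTests

section Constants

variable {α : Type} [Primcodable α]

theorem uniformlyLowerSemicomputable_cylPair_one :
    UniformlyLowerSemicomputable cylPair fun (_ : α) _ => 1 :=
  (uniformlyLowerSemicomputable_natCast_initSeg (h := fun _ => 1) (n := fun _ => 0) (by fun_prop)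
    (by fun_prop)).congr fun _ _ => Nat.cast_one.symm

theorem IsMaximalTest.exists_one_le {μ : Measure Cantor} [IsProbabilityMeasure μ]
    {t : Cantor → ℝ≥0∞} (ht : IsMaximalTest cyl μ t) : ∃ n : ℕ, ∀ ω, 1 ≤ 2 ^ n * t ω :=
  ht.exists_le_two_pow_mul (s := fun _ => 1) ⟨lowerSemicomputable_iff.2
    (uniformlyLowerSemicomputable_cylPair_one.preimage
      (effectivelyOpen_preimage_prodMk computable_initSeg_false)), by simp⟩

theorem IsMaximalCondTest.exists_one_le {κ : Kernel Cantor Cantor} [IsMarkovKernel κ]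
    {t : Cantor × Cantor × ℤ → ℝ≥0∞} (ht : IsMaximalCondTest κ t) :
    ∃ n : ℕ, ∀ y, 1 ≤ 2 ^ n * t y := by
  obtain ⟨C, hC⟩ := ht.maximal (fun _ => 1)
    ⟨lowerSemicomputable_cylCond_iff.2 uniformlyLowerSemicomputable_cylPair_one, by simp⟩
  obtain ⟨n, hn⟩ := exists_le_two_pow C
  exact ⟨n, fun y => (hC y).trans (by gcongr)⟩

end Constants

/-- The numbers `x` and `2 ^ k` agree up to the factor `2 ^ R`. As in `IsRounding`, every integer
is near `⊤`. -/
def Near (R : ℕ) (k : ℤ) (x : ℝ≥0∞) : Prop :=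
  x ≠ ⊤ → x ≤ 2 ^ R * 2 ^ k ∧ (2 : ℝ≥0∞) ^ k ≤ 2 ^ R * x

theorem exists_near {x : ℝ≥0∞} (hx : x ≠ 0) : ∃ k, Near 1 k x := by
  rcases eq_or_ne x ⊤ with rfl | hx'
  · exact ⟨0, fun h => absurd rfl h⟩
  obtain ⟨n, hn, hn'⟩ := ENNReal.exists_mem_Ioc_zpow hx hx' ENNReal.one_lt_two (by simp)
  refine ⟨n, fun _ => ⟨?_, ?_⟩⟩
  · rw [pow_one]
    rwa [ENNReal.zpow_add (by simp) (by simp), zpow_one, mul_comm] at hn'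
  · exact hn.le.trans (le_mul_of_one_le_left' (by simp))

section Pair

variable {P₁ : Measure Cantor} {κ : Kernel Cantor Cantor} [IsMarkovKernel κ]
  {t₁ : Cantor → ℝ≥0∞} {t₂ : Cantor × Cantor × ℤ → ℝ≥0∞}

theorem IsTest.lintegral_kernel [SFinite P₁] (hκ : IsUniformlyComputable κ)
    {s : Cantor × Cantor → ℝ≥0∞} (hs : IsTest cylPair (P₁.compProd κ) s) :
    IsTest cyl P₁ fun ω => ∫⁻ ω', s (ω, ω') ∂κ ω := by
  have hlsc := lowerSemicomputable_iff.1 hs.lowerSemicomputable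
  refine ⟨lowerSemicomputable_iff.2 (hlsc.lintegral_kernel hκ), ?_⟩
  rw [← Measure.lintegral_compProd (hlsc.measurable measurableSet_cylPair ())]
  exact hs.lintegral_le_one

theorem IsTest.exists_le_mul [SFinite P₁] (hκ : IsUniformlyComputable κ)
    (ht₁ : IsMaximalTest cyl P₁ t₁) (ht₂ : IsMaximalCondTest κ t₂) {s : Cantor × Cantor → ℝ≥0∞}
    (hs : IsTest cylPair (P₁.compProd κ) s) (R : ℕ) :
    ∃ n : ℕ, ∀ ω ω' k, Near R k (t₁ ω) → s (ω, ω') ≤ 2 ^ n * (t₁ ω * t₂ (ω', ω, k)) := by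
  obtain ⟨A, hA⟩ := ht₁.exists_le_two_pow_mul (hs.lintegral_kernel hκ)
  obtain ⟨E, hE⟩ := ht₂.exists_one_le
  have hlsc := (((lowerSemicomputable_iff.1 hs.lowerSemicomputable).comp (.const ())).two_zpow_mul
    (e := fun _ => -((A + R : ℕ) : ℤ)) (.const _)).two_zpow_mul (e := fun k : ℤ => -k) (by fun_prop)
  simp only [ENNReal.zpow_neg, zpow_natCast] at hlsc
  obtain ⟨B, hB⟩ := ht₂.exists_le_two_pow_mul hκ hlsc
  refine ⟨A + 2 * R + B, fun ω ω' k hk => ?_⟩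
  rcases eq_or_ne (t₁ ω) ⊤ with htop | htop
  · have hne : t₂ (ω', ω, k) ≠ 0 := fun h => by simpa [h] using hE (ω', ω, k)
    simp [htop, ENNReal.top_mul hne, ENNReal.mul_top]
  have h2k : (2 : ℝ≥0∞) ^ k ≠ 0 := (ENNReal.zpow_pos (by simp) (by simp) k).ne'
  have h2k' : (2 : ℝ≥0∞) ^ k ≠ ⊤ := ENNReal.zpow_ne_top (by simp) (by simp) k
  obtain ⟨hle, hge⟩ := hk htop
  have hint : ∫⁻ ω', (2 ^ k)⁻¹ * ((2 ^ (A + R))⁻¹ * s (ω, ω')) ∂κ ω ≤ 1 := by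
    rw [lintegral_const_mul' _ _ (by simpa using h2k), lintegral_const_mul' _ _ (by simp),
      ENNReal.inv_mul_le_iff h2k h2k', ENNReal.inv_mul_le_iff (by simp) (by simp), mul_one]
    calc ∫⁻ ω', s (ω, ω') ∂κ ω ≤ 2 ^ A * t₁ ω := hA ω
      _ ≤ 2 ^ A * (2 ^ R * 2 ^ k) := by gcongr
      _ = 2 ^ (A + R) * 2 ^ k := by rw [pow_add, mul_assoc]
  have hs_le := hB k ω hint ω'
  rw [ENNReal.inv_mul_le_iff h2k h2k', ENNReal.inv_mul_le_iff (by simp) (by simp)] at hs_le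
  calc s (ω, ω') ≤ 2 ^ (A + R) * (2 ^ k * (2 ^ B * t₂ (ω', ω, k))) := hs_le
    _ ≤ 2 ^ (A + R) * (2 ^ R * t₁ ω * (2 ^ B * t₂ (ω', ω, k))) := by gcongr
    _ = 2 ^ (A + 2 * R + B) * (t₁ ω * t₂ (ω', ω, k)) := by ring

theorem tsum_iSup_two_zpow_lt_le (x : ℝ≥0∞) :
    ∑' k : ℤ, (⨆ (_ : (2 : ℝ≥0∞) ^ k < x), (2 : ℝ≥0∞) ^ k) ≤ 2 * x := by
  rcases eq_or_ne x ⊤ with rfl | hx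
  · simp
  rcases eq_or_ne x 0 with rfl | hx0
  · simp
  obtain ⟨n, hn, hn'⟩ := ENNReal.exists_mem_Ioc_zpow hx0 hx ENNReal.one_lt_two (by simp)
  have hinj : Function.Injective fun i : ℕ => n - (i : ℤ) := fun i j h => by simpa using h
  rw [← hinj.tsum_eq]
  · calc ∑' i : ℕ, (⨆ (_ : (2 : ℝ≥0∞) ^ (n - (i : ℤ)) < x), (2 : ℝ≥0∞) ^ (n - (i : ℤ)))
        ≤ ∑' i : ℕ, 2 ^ n * (2⁻¹ : ℝ≥0∞) ^ i := by
          refine ENNReal.tsum_le_tsum fun i => iSup_le fun _ => le_of_eq ?_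
          rw [ENNReal.zpow_sub (by simp) (by simp)]
          simp [ENNReal.inv_pow]
      _ = 2 ^ n * 2 := by rw [ENNReal.tsum_mul_left, ENNReal.tsum_geometric_two]
      _ ≤ 2 * x := by rw [mul_comm]; gcongr
  · intro k hk
    have hlt : (2 : ℝ≥0∞) ^ k < x := by
      by_contra h
      exact hk (by simp [h])
    have hkn : k < n + 1 := by
      by_contra! h
      exact (hlt.trans_le hn').not_ge (ENNReal.zpow_le_of_le one_le_two h)
    exact ⟨(n - k).toNat, by simp; omega⟩

/-- The test for the pair obtained from a test for the first component and a conditional test, with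
all the lower bounds of the first one, up to the factor `2 ^ j`, put in the condition. -/
noncomputable def prodTest (t₁ : Cantor → ℝ≥0∞) (t₂ : Cantor × Cantor × ℤ → ℝ≥0∞) (j : ℕ)
    (x : Cantor × Cantor) : ℝ≥0∞ :=
  (2 ^ (j + 1))⁻¹ *
    ⨆ k : ℤ, ⨆ (_ : (2 : ℝ≥0∞) ^ k < 2 ^ j * t₁ x.1), 2 ^ k * t₂ (x.2, x.1, k)

theorem lowerSemicomputable_prodTest (h₁ : LowerSemicomputable cyl t₁)
    (h₂ : LowerSemicomputable cylCond t₂) (j : ℕ) :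
    LowerSemicomputable cylPair (prodTest t₁ t₂ j) := by
  have hguard : EffectivelyOpen cyl fun k : ℤ => {ω | (2 : ℝ≥0∞) ^ k < 2 ^ j * t₁ ω} := by
    refine (EffectivelyOpen.comp ((((lowerSemicomputable_iff.1 h₁).comp (.const ())).two_zpow_mul
      (e := fun _ => (j : ℤ)) (.const _)).two_zpow_mul (e := fun k : ℤ => -k) (by fun_prop))
        (g := fun k => (k, 1, 0)) (by fun_prop)).congr fun k ω => ?_
    have h2k : (2 : ℝ≥0∞) ^ k ≠ 0 := (ENNReal.zpow_pos (by simp) (by simp) k).ne'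
    have h2k' : (2 : ℝ≥0∞) ^ k ≠ ⊤ := ENNReal.zpow_ne_top (by simp) (by simp) k
    simp only [Set.mem_ofPred_eq, Nat.cast_one, Nat.cast_zero, zero_add, div_one, zpow_natCast]
    rw [ENNReal.zpow_neg, mul_comm _ (_ * _), ← div_eq_mul_inv,
      ENNReal.lt_div_iff_mul_lt (.inl h2k) (.inl h2k'), one_mul]
  have hterm := (((lowerSemicomputable_cylCond_iff.1 h₂).two_zpow_mul .id).iSup_mem
    effectivelyOpen_cylPair_inter (hguard.preimage effectivelyOpen_preimage_fst)).comp
      (β := Unit × ℤ) .snd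
  refine lowerSemicomputable_iff.2 ((hterm.iSup.two_zpow_mul (e := fun _ => -((j + 1 : ℕ) : ℤ))
    (.const _)).congr fun _ x => ?_)
  rw [ENNReal.zpow_neg, zpow_natCast]
  rfl

theorem lintegral_prodTest_le (h₂ : IsCondTest κ t₂) (j : ℕ) (ω : Cantor) :
    ∫⁻ ω', prodTest t₁ t₂ j (ω, ω') ∂κ ω ≤ t₁ ω := by
  have hmeas (k : ℤ) : Measurable fun ω' => t₂ (ω', ω, k) :=
    ((lowerSemicomputable_cylCond_iff.1 h₂.lowerSemicomputable).measurable measurableSet_cylPair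
      k).comp measurable_prodMk_left
  have hmeas' (k : ℤ) : Measurable fun ω' =>
      ⨆ (_ : (2 : ℝ≥0∞) ^ k < 2 ^ j * t₁ ω), 2 ^ k * t₂ (ω', ω, k) :=
    .iSup fun _ => (hmeas k).const_mul _
  simp only [prodTest]
  rw [lintegral_const_mul' _ _ (by simp), ENNReal.inv_mul_le_iff (by simp) (by simp)]
  calc ∫⁻ ω', ⨆ k : ℤ, ⨆ (_ : (2 : ℝ≥0∞) ^ k < 2 ^ j * t₁ ω), 2 ^ k * t₂ (ω', ω, k) ∂κ ω
      ≤ ∫⁻ ω', ∑' k : ℤ, ⨆ (_ : (2 : ℝ≥0∞) ^ k < 2 ^ j * t₁ ω), 2 ^ k * t₂ (ω', ω, k) ∂κ ω :=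
        lintegral_mono fun ω' => iSup_le fun k => ENNReal.le_tsum (f := fun k : ℤ =>
          ⨆ (_ : (2 : ℝ≥0∞) ^ k < 2 ^ j * t₁ ω), 2 ^ k * t₂ (ω', ω, k)) k
    _ = ∑' k : ℤ, ∫⁻ ω', ⨆ (_ : (2 : ℝ≥0∞) ^ k < 2 ^ j * t₁ ω), 2 ^ k * t₂ (ω', ω, k) ∂κ ω :=
        lintegral_tsum fun k => (hmeas' k).aemeasurable
    _ ≤ ∑' k : ℤ, ⨆ (_ : (2 : ℝ≥0∞) ^ k < 2 ^ j * t₁ ω), (2 : ℝ≥0∞) ^ k := by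
        refine ENNReal.tsum_le_tsum fun k => ?_
        by_cases hk : (2 : ℝ≥0∞) ^ k < 2 ^ j * t₁ ω
        · simp only [hk, iSup_pos]
          rw [lintegral_const_mul _ (hmeas k)]
          exact mul_le_of_le_one_right' (h₂.lintegral_le_one ω k)
        · simp [hk]
    _ ≤ 2 * (2 ^ j * t₁ ω) := tsum_iSup_two_zpow_lt_le _
    _ = 2 ^ (j + 1) * t₁ ω := by ring

theorem isTest_prodTest [SFinite P₁] (h₁ : IsTest cyl P₁ t₁) (h₂ : IsCondTest κ t₂) (j : ℕ) :
    IsTest cylPair (P₁.compProd κ) (prodTest t₁ t₂ j) := by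
  have hlsc := lowerSemicomputable_prodTest h₁.lowerSemicomputable h₂.lowerSemicomputable j
  refine ⟨hlsc, ?_⟩
  rw [Measure.lintegral_compProd
    ((lowerSemicomputable_iff.1 hlsc).measurable measurableSet_cylPair ())]
  exact (lintegral_mono (lintegral_prodTest_le h₂ j)).trans h₁.lintegral_le_one

theorem two_zpow_mul_le_prodTest {j : ℕ} {ω : Cantor} {k : ℤ} (hk : 2 ^ k < 2 ^ j * t₁ ω)
    (ω' : Cantor) : 2 ^ k * t₂ (ω', ω, k) ≤ 2 ^ (j + 1) * prodTest t₁ t₂ j (ω, ω') := by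
  rw [prodTest, ENNReal.mul_inv_cancel_left (by simp) (by simp)]
  exact le_iSup₂_of_le k hk le_rfl

theorem prodTest_eq_top {E : ℕ} (hE : ∀ y, 1 ≤ 2 ^ E * t₂ y) (j : ℕ) {ω : Cantor}
    (hω : t₁ ω = ⊤) (ω' : Cantor) : prodTest t₁ t₂ j (ω, ω') = ⊤ := by
  suffices h : 2 ^ (j + 1) * prodTest t₁ t₂ j (ω, ω') = ⊤ by
    by_contra hne
    exact ENNReal.mul_ne_top (by finiteness) hne h
  refine ENNReal.eq_top_of_forall_nnreal_le fun C => ?_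
  obtain ⟨n, hn⟩ := exists_le_two_pow C
  have hlt : (2 : ℝ≥0∞) ^ ((n + E : ℕ) : ℤ) < 2 ^ j * t₁ ω := by
    rw [hω, ENNReal.mul_top (by positivity), zpow_natCast]
    finiteness
  calc (C : ℝ≥0∞) ≤ 2 ^ n * 1 := by simpa using hn
    _ ≤ 2 ^ n * (2 ^ E * t₂ (ω', ω, ((n + E : ℕ) : ℤ))) := by gcongr; exact hE _
    _ = 2 ^ ((n + E : ℕ) : ℤ) * t₂ (ω', ω, ((n + E : ℕ) : ℤ)) := by
        rw [zpow_natCast, pow_add, mul_assoc]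
    _ ≤ 2 ^ (j + 1) * prodTest t₁ t₂ j (ω, ω') := two_zpow_mul_le_prodTest hlt ω'

theorem mul_le_prodTest {D E : ℕ} (hD : ∀ ω, 1 ≤ 2 ^ D * t₁ ω) (hE : ∀ y, 1 ≤ 2 ^ E * t₂ y)
    {R : ℕ} {ω : Cantor} {k : ℤ} (hk : Near R k (t₁ ω)) (ω' : Cantor) :
    t₁ ω * t₂ (ω', ω, k) ≤ 2 ^ (2 * R + 2) * prodTest t₁ t₂ (R + 1) (ω, ω') := by
  rcases eq_or_ne (t₁ ω) ⊤ with htop | htop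
  · simp [prodTest_eq_top hE _ htop, ENNReal.mul_top]
  obtain ⟨hle, hge⟩ := hk htop
  have hpos : t₁ ω ≠ 0 := fun h => by simpa [h] using hD ω
  have hlt : (2 : ℝ≥0∞) ^ k < 2 ^ (R + 1) * t₁ ω := by
    refine hge.trans_lt ?_
    rw [pow_succ, mul_right_comm, mul_two]
    exact ENNReal.lt_add_right (by finiteness) (mul_ne_zero (by positivity) hpos)
  calc t₁ ω * t₂ (ω', ω, k) ≤ 2 ^ R * 2 ^ k * t₂ (ω', ω, k) := by gcongr
    _ = 2 ^ R * (2 ^ k * t₂ (ω', ω, k)) := mul_assoc _ _ _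
    _ ≤ 2 ^ R * (2 ^ (R + 1 + 1) * prodTest t₁ t₂ (R + 1) (ω, ω')) :=
        mul_le_mul' le_rfl (two_zpow_mul_le_prodTest hlt ω')
    _ = 2 ^ (2 * R + 2) * prodTest t₁ t₂ (R + 1) (ω, ω') := by ring

theorem IsMaximalTest.exists_mul_le [IsProbabilityMeasure P₁] {t : Cantor × Cantor → ℝ≥0∞}
    (ht : IsMaximalTest cylPair (P₁.compProd κ) t) (ht₁ : IsMaximalTest cyl P₁ t₁)
    (ht₂ : IsMaximalCondTest κ t₂) (R : ℕ) :
    ∃ n : ℕ, ∀ ω ω' k, Near R k (t₁ ω) → t₁ ω * t₂ (ω', ω, k) ≤ 2 ^ n * t (ω, ω') := by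
  obtain ⟨D, hD⟩ := ht₁.exists_one_le
  obtain ⟨E, hE⟩ := ht₂.exists_one_le
  obtain ⟨n, hn⟩ := ht.exists_le_two_pow_mul (isTest_prodTest ht₁.isTest ht₂.isCondTest (R + 1))
  refine ⟨2 * R + 2 + n, fun ω ω' k hk => (mul_le_prodTest hD hE hk ω').trans ?_⟩
  rw [pow_add _ (2 * R + 2), mul_assoc]
  gcongr
  exact hn _

theorem exists_isMaximalTest_compProd [IsProbabilityMeasure P₁] (hP₁ : IsComputableMeasure P₁)
    (hκ : IsUniformlyComputable κ) : ∃ t, IsMaximalTest cylPair (P₁.compProd κ) t := by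
  obtain ⟨t₁, ht₁⟩ := exists_isMaximalTest hP₁
  obtain ⟨t₂, ht₂⟩ := exists_isMaximalCondTest hκ
  obtain ⟨D, hD⟩ := ht₁.exists_one_le
  obtain ⟨E, hE⟩ := ht₂.exists_one_le
  refine ⟨prodTest t₁ t₂ 2, isTest_prodTest ht₁.isTest ht₂.isCondTest 2, fun s hs => ?_⟩
  obtain ⟨n, hn⟩ := hs.exists_le_mul hκ ht₁ ht₂ 1
  refine ⟨2 ^ (n + 4), ?_⟩
  rintro ⟨ω, ω'⟩
  obtain ⟨k, hk⟩ := exists_near (x := t₁ ω) fun h => by simpa [h] using hD ω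
  calc s (ω, ω') ≤ 2 ^ n * (t₁ ω * t₂ (ω', ω, k)) := hn ω ω' k hk
    _ ≤ 2 ^ n * (2 ^ 4 * prodTest t₁ t₂ 2 (ω, ω')) :=
        mul_le_mul' le_rfl (mul_le_prodTest hD hE hk ω')
    _ = ((2 ^ (n + 4) : ℝ≥0) : ℝ≥0∞) * prodTest t₁ t₂ 2 (ω, ω') := by push_cast; ring

end Pair

section Log2

theorem log_two_pos : (0 : EReal) < ((Real.log 2 : ℝ) : EReal) :=
  EReal.coe_pos.2 (Real.log_pos one_lt_two)

theorem log2_strictMono : StrictMono log2 :=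
  (EReal.strictMono_div_right_of_pos log_two_pos (EReal.coe_ne_top _)).comp ENNReal.log_strictMono

theorem log2_mul (x y : ℝ≥0∞) : log2 (x * y) = log2 x + log2 y := by
  unfold log2
  rw [ENNReal.log_mul_add]
  exact EReal.right_distrib_of_nonneg_of_ne_top
    (EReal.inv_nonneg_of_nonneg log_two_pos.le) (EReal.inv_lt_top _).ne _ _

theorem log2_two_rpow (x : ℝ) : log2 (2 ^ x) = (x : EReal) := by
  have h : ENNReal.log 2 = ((Real.log 2 : ℝ) : EReal) := by
    have := ENNReal.log_ofReal_of_pos (x := 2) two_pos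
    simpa using this
  rw [log2, ENNReal.log_rpow, h, ← EReal.coe_mul, ← EReal.coe_div,
    mul_div_assoc, div_self (Real.log_pos one_lt_two).ne', mul_one]

theorem IsRounding.near {r : ℝ} {x : ℝ≥0∞} {k : ℤ} (h : IsRounding r (log2 x) k) {R : ℕ}
    (hR : r ≤ R) : Near R k x := by
  intro hx
  have htop : log2 ⊤ = ⊤ := by
    rw [log2, ENNReal.log_top]
    exact EReal.top_div_of_pos_ne_top log_two_pos (EReal.coe_ne_top _)
  have hlog : log2 x ≠ ⊤ := fun h => hx (log2_strictMono.injective (h.trans htop.symm))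
  obtain ⟨hle, hge⟩ := h hlog
  have hR2 : log2 (2 ^ R) = ((R : ℝ) : EReal) := by
    rw [← ENNReal.rpow_natCast, log2_two_rpow]
  have hk : log2 (2 ^ k) = ((k : ℝ) : EReal) := by
    rw [← ENNReal.rpow_intCast, log2_two_rpow]
  constructor
  · rw [← log2_strictMono.le_iff_le, log2_mul, hR2, hk, ← EReal.coe_add]
    exact hle.trans (EReal.coe_le_coe_iff.2 (by linarith))
  · rw [← log2_strictMono.le_iff_le, log2_mul, hR2, hk]
    calc ((k : ℝ) : EReal) ≤ ((R + (k - r) : ℝ) : EReal) := EReal.coe_le_coe_iff.2 (by linarith)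
      _ = (R : ℝ) + ((k - r : ℝ) : EReal) := EReal.coe_add _ _
      _ ≤ _ := by gcongr

theorem log2_le_add_of_le {x y : ℝ≥0∞} {n : ℕ} (h : x ≤ 2 ^ n * y) {c : ℝ} (hc : n ≤ c) :
    log2 x ≤ log2 y + c := by
  calc log2 x ≤ log2 (2 ^ n * y) := log2_strictMono.monotone h
    _ = log2 y + ((n : ℝ) : EReal) := by
      rw [log2_mul, ← ENNReal.rpow_natCast, log2_two_rpow, add_comm]
    _ ≤ log2 y + c := by
      gcongr

end Log2

end VovkVyugin

theorem mainTheorem6 (P₁ : Measure Cantor) [IsProbabilityMeasure P₁]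
    (hP₁ : IsComputableMeasure P₁)
    (κ : Kernel Cantor Cantor) [IsMarkovKernel κ] (hκ : IsUniformlyComputable κ) :
    (∃ t₁, IsMaximalTest cyl P₁ t₁) ∧
    (∃ t, IsMaximalTest cylPair (P₁.compProd κ) t) ∧
    (∃ t₂, IsMaximalCondTest κ t₂) ∧
    ∀ (t₁ : Cantor → ℝ≥0∞) (t : Cantor × Cantor → ℝ≥0∞) (t₂ : Cantor × Cantor × ℤ → ℝ≥0∞),
      IsMaximalTest cyl P₁ t₁ →
      IsMaximalTest cylPair (P₁.compProd κ) t →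
      IsMaximalCondTest κ t₂ →
      ∀ r : ℝ, ∃ c : ℝ, ∀ (ω ω' : Cantor) (k : ℤ), IsRounding r (deficiency t₁ ω) k →
        deficiency t (ω, ω') ≤ deficiency t₁ ω + deficiency t₂ (ω', ω, k) + (c : EReal) ∧
        deficiency t₁ ω + deficiency t₂ (ω', ω, k) ≤ deficiency t (ω, ω') + (c : EReal) := by
  refine ⟨exists_isMaximalTest hP₁, exists_isMaximalTest_compProd hP₁ hκ,
    exists_isMaximalCondTest hκ, fun t₁ t t₂ ht₁ ht ht₂ r => ?_⟩
  obtain ⟨R, hR⟩ := exists_nat_ge r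
  obtain ⟨m, hm⟩ := ht.isTest.exists_le_mul hκ ht₁ ht₂ R
  obtain ⟨n, hn⟩ := ht.exists_mul_le ht₁ ht₂ R
  refine ⟨max m n, fun ω ω' k hk => ?_⟩
  have hnear : Near R k (t₁ ω) := IsRounding.near hk hR
  simp only [deficiency, ← log2_mul]
  exact ⟨log2_le_add_of_le (hm ω ω' k hnear) (le_max_left _ _),
    log2_le_add_of_le (hn ω ω' k hnear) (le_max_right _ _)⟩
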